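/- Let $p$ be a prime, let $V$ be a Noetherian integral scheme of characteristic $p$, and let $f : X \to V$ be a separated, flat, geometrically reduced morphism of finite type. For $m \ge 0$ let $V^m$ be $V$ regarded as a $V$-scheme through the $m$-th iterated absolute Frobenius, put $X_{V^m} = X \times_V V^m$, and for a quasi-coherent sheaf $M$ on $X$ write $M^{1/p^m}$ for its direct image under the relative Frobenius $F^m_{X/V} : X \to X_{V^m}$. Fix an integer $e \ge 1$, a line bundle $L$ on $X$ and an $\mathcal O_{X_{V^e}}$-linear map $\varphi : L^{1/p^e} \to \mathcal O_{X_{V^e}}$ (possibly zero). Put $\varphi^0 = \mathrm{id}$ and let $$\varphi^n : \bigl(L^{\frac{p^{ne}-1}{p^e-1}}\bigr)^{1/p^{ne}} = \Bigl(L \otimes \bigl(L^{\frac{p^{(n-1)e}-1}{p^e-1}}\bigr)^{1/p^{(n-1)e}}\Bigr)^{1/p^e} \longrightarrow \bigl(L \otimes \mathcal O_{X_{V^{(n-1)e}}}\bigr)^{1/p^e} \longrightarrow \mathcal O_{X_{V^{ne}}}$$ be the composition of $(\mathrm{id}_L \otimes \varphi^{n-1})^{1/p^e}$ with the base change of $\varphi$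 along $V^{ne} \to V^e$. Let $\sigma_n(X/V,\varphi) \subseteq \mathcal O_{X_{V^{ne}}}$ be the image of $\varphi^n$. A perfect point of $V$ is a morphism $s = \operatorname{Spec} K \to V$ with $K$ a perfect field. Since $K^{1/p^m} = K$, the fiber $X_{s^{ne}}$ of $X_{V^{ne}} \to V^{ne}$ over $s$ is identified with $X_s = X \times_V s$, and the base change $\varphi_s$ of $\varphi$ to $s$ is identified with a $p^{-e}$-linear map $\psi_s : (L|_{X_s})^{1/p^e} \to \mathcal O_{X_s}$, where now $M^{1/p^e}$ denotes $F^e_* M$ for the absolute Frobenius of $X_s$. Let $\psi_s^n$ be its $n$-fold composition with itself and let $\sigma(X_s,\psi_s) = \bigcap_{n \ge 0} \operatorname{Im}(\psi_s^n) \subseteq \mathcal O_{X_s}$ be the absolute non-$F$-pure ideal. Then: (1) There is an integer $N \ge 0$ such that for all $n \ge N$ and all perfect points $s$ of $V$, $$\sigma_n(X/V,\varphi)\cdot \mathcal O_{X_{s^{ne}}} = \sigma(X_s,\psi_s).$$ (2) For every $n \ge 0$ and every morphism $g : T \to V$, the ideal $\sigma_n(X/V,\varphi)$ maps surjectively onto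 its base change: $\sigma_n(X/V,\varphi)\cdot \mathcal O_{X_{T^{ne}}} = \sigma_n(X_T/T,\varphi_T)$, where $X_T = X\times_V T$ and $\varphi_T$ is the base change of $\varphi$. -/

import Mathlib

open CategoryTheory CategoryTheory.Limits AlgebraicGeometry TopologicalSpace
open scoped TensorProduct

universe u

namespace RelFPure

noncomputable section

/-! ## Frobenius and `p^m`-th roots of rings -/

section Frobenius

variable {p : ℕ} [Fact p.Prime] {A : Type u} [CommRing A]

/-- The iterated Frobenius `x ↦ x ^ (p ^ m)` of a ring in which `p = 0`
(the zero ring is allowed). -/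
def frob (h : (p : A) = 0) (m : ℕ) : A →+* A where
  toFun x := x ^ p ^ m
  map_one' := one_pow _
  map_mul' x y := mul_pow x y _
  map_zero' := zero_pow (pow_ne_zero _ (Fact.out : p.Prime).ne_zero)
  map_add' x y := by
    rcases subsingleton_or_nontrivial A with _ | _
    · exact Subsingleton.elim _ _
    · have := (CharP.charP_iff_prime_eq_zero (Fact.out : p.Prime)).2 h
      exact add_pow_char_pow x y p m

/-- The ring `A^{1/p^m}`: the ring `A` itself, an element `a` standing for `a^{1/p^m}`.
It is an algebra over `A`, and over every ring mapping to `A`, through the `m`-th Frobenius. -/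
def RootRing (_h : (p : A) = 0) (_m : ℕ) : Type u := A

instance (h : (p : A) = 0) (m : ℕ) : CommRing (RootRing h m) := inferInstanceAs (CommRing A)

/-- The bijection `a ↦ a^{1/p^m}`, a ring isomorphism from `A` to `A^{1/p^m}`. -/
def toRoot (h : (p : A) = 0) (m : ℕ) : A ≃+* RootRing h m := RingEquiv.refl A

instance (h : (p : A) = 0) (m : ℕ) {A₀ : Type u} [CommRing A₀] [Algebra A₀ A] :
    Algebra A₀ (RootRing h m) :=
  (((toRoot h m).toRingHom.comp (frob h m)).comp (algebraMap A₀ A)).toAlgebra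

theorem algebraMap_root (h : (p : A) = 0) (m : ℕ) {A₀ : Type u} [CommRing A₀] [Algebra A₀ A]
    (a : A₀) : algebraMap A₀ (RootRing h m) a = toRoot h m (algebraMap A₀ A a ^ p ^ m) := rfl

end Frobenius

theorem natCast_eq_zero_of_ringHom {p : ℕ} {A B : Type u} [CommRing A] [CommRing B]
    (g : A →+* B) (h : (p : A) = 0) : (p : B) = 0 := by
  rw [← map_natCast g, h, map_zero]

/-! ## Absolute `p^{-e}`-linear maps -/

section Absolute

variable (p : ℕ) [Fact p.Prime] (e : ℕ) (S M : Type u) [CommRing S] [AddCommGroup M] [Module S M]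

/-- A `p^{-e}`-linear map `ψ : M → S`, that is an `S`-linear map `M^{1/p^e} → S`. -/
structure CartierMap where
  /-- the underlying additive map -/
  toFun : M →+ S
  map_pow_smul : ∀ (s : S) (x : M), toFun (s ^ p ^ e • x) = s * toFun x

variable {S}

/-- The `S`-module `(M^{1 + q + ⋯ + q^{n-1}})^{1/q^n}`, for `M` invertible, `q = p^e`
and `F` the `e`-th Frobenius of `S`: it is `S` for `n = 0`, and
`(M ⊗_S (M^{1 + q + ⋯ + q^{n-1}})^{1/q^n})^{1/q}` for `n + 1`. -/
def rootPower (F : S →+* S) : ℕ → ModuleCat.{u} S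
  | 0 => ModuleCat.of S S
  | n + 1 => (ModuleCat.restrictScalars F).obj (ModuleCat.of S (M ⊗[S] rootPower F n))

variable {p e M}

/-- The `n`-fold composition `ψ^n : (M^{1 + q + ⋯ + q^{n-1}})^{1/q^n} → S` with `q = p^e`:
the map `ψ^{n+1}` is the composition
`(M ⊗_S (M^{1 + q + ⋯ + q^{n-1}})^{1/q^n})^{1/q} → (M ⊗_S S)^{1/q} = M^{1/q} → S`
of `(id ⊗ ψ^n)^{1/q}` and `ψ`. -/
def CartierMap.pow (h : (p : S) = 0) (ψ : CartierMap p e S M) :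
    (n : ℕ) → rootPower M (frob h e) n →ₗ[S] S
  | 0 => LinearMap.id
  | n + 1 =>
    let g : M ⊗[S] rootPower M (frob h e) n →ₗ[S] M :=
      (TensorProduct.rid S M).toLinearMap ∘ₗ LinearMap.lTensor M (ψ.pow h n)
    { toFun := fun y => ψ.toFun (g y)
      map_add' := fun y z => (congrArg ψ.toFun (g.map_add y z)).trans (map_add _ _ _)
      map_smul' := fun s y =>
        (congrArg ψ.toFun (g.map_smul (frob h e s) y)).trans (ψ.map_pow_smul s _) }

/-- The absolute non-`F`-pure ideal `σ(S, ψ) = ⋂ₙ ψ^n ((M^{1 + q + ⋯ + q^{n-1}})^{1/q^n})`. -/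
def CartierMap.sigma (h : (p : S) = 0) (ψ : CartierMap p e S M) : Ideal S :=
  ⨅ n, LinearMap.range (ψ.pow h n)

end Absolute

/-! ## Relative `p^{-e}`-linear maps in the affine case -/

section Relative

variable {p : ℕ} [Fact p.Prime] {A : Type u} [CommRing A]

/-- An `R_{A^{1/p^e}}`-linear map `φ : L^{1/p^e} → R_{A^{1/p^e}} = R ⊗_A A^{1/p^e}`.
The element `r ⊗ a^{1/p^e}` acts on `L^{1/p^e}` as `r^{p^e} a` does on `L`. -/
structure RelCartierMap (h : (p : A) = 0) (e : ℕ) (R L : Type u) [CommRing R] [Algebra A R]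
    [AddCommGroup L] [Module R L] where
  /-- the underlying additive map -/
  toFun : L →+ R ⊗[A] RootRing h e
  map_pow_smul : ∀ (r : R) (l : L), toFun (r ^ p ^ e • l) = (r ⊗ₜ 1) * toFun l
  map_base_smul : ∀ (a : A) (l : L),
    toFun (algebraMap A R a • l) = (1 ⊗ₜ toRoot h e a) * toFun l

variable {h : (p : A) = 0} {e : ℕ} {R L : Type u} [CommRing R] [Algebra A R]
  [AddCommGroup L] [Module R L]

/-- Let `j : B → C` present `C` as the ring `B^{1/p^e}`, as an `A`-algebra. Then
`a^{1/p^e} ↦ a^{1/p^e}` is an `A`-algebra map from `A^{1/p^e}` to `C`. -/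
def rootLift (h : (p : A) = 0) (e : ℕ) {B C : Type u} [CommRing B] [CommRing C] [Algebra A B]
    [Algebra A C] (j : B →+* C) (hj : ∀ a, algebraMap A C a = j (algebraMap A B a) ^ p ^ e) :
    RootRing h e →ₐ[A] C :=
  { (j.comp (algebraMap A B)).comp (toRoot h e).symm.toRingHom with
    commutes' := fun a => by
      rw [hj, algebraMap_root]
      simp }

theorem rootLift_toRoot (h : (p : A) = 0) (e : ℕ) {B C : Type u} [CommRing B] [CommRing C]
    [Algebra A B] [Algebra A C] (j : B →+* C)
    (hj : ∀ a, algebraMap A C a = j (algebraMap A B a) ^ p ^ e) (a : A) :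
    rootLift h e j hj (toRoot h e a) = j (algebraMap A B a) := rfl

/-- Let `j : B → C` present `C` as the ring `B^{1/p^e}`, as an `A`-algebra.
This is `φ ⊗_{A^{1/p^e}} B^{1/p^e}` as a map from `(R_B ⊗_R L)^{1/p^e}` to `R ⊗_A B^{1/p^e}`:
`(r ⊗ b) ⊗ l ↦ φ (r l) b^{1/p^e}`. -/
def RelCartierMap.extend (φ : RelCartierMap h e R L) {B C : Type u} [CommRing B] [CommRing C]
    [Algebra A B] [Algebra A C] (j : B →+* C)
    (hj : ∀ a, algebraMap A C a = j (algebraMap A B a) ^ p ^ e) :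
    (R ⊗[A] B) ⊗[R] L →+ R ⊗[A] C :=
  let θ : R ⊗[A] RootRing h e →+* R ⊗[A] C :=
    (Algebra.TensorProduct.map (AlgHom.id A R) (rootLift h e j hj)).toRingHom
  let g (l : L) : R ⊗[A] B →+ R ⊗[A] C :=
    TensorProduct.liftAddHom
      { toFun := fun r => (AddMonoidHom.mulLeft (θ (φ.toFun (r • l)))).comp
          ((Algebra.TensorProduct.includeRight : C →ₐ[A] R ⊗[A] C).toRingHom.comp j).toAddMonoidHom
        map_zero' := by ext; simp
        map_add' := fun x y => by ext; simp [add_smul, add_mul] }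
      (fun a r b => by
        have : φ.toFun ((a • r) • l) = (1 ⊗ₜ toRoot h e a) * φ.toFun (r • l) := by
          rw [← φ.map_base_smul, Algebra.smul_def, mul_smul]
        change θ (φ.toFun ((a • r) • l)) * (1 ⊗ₜ j b) = θ (φ.toFun (r • l)) * (1 ⊗ₜ j (a • b))
        have hθ : θ (1 ⊗ₜ toRoot h e a) = 1 ⊗ₜ j (algebraMap A B a) := by
          simp [θ, rootLift_toRoot]
        rw [this, map_mul, hθ, mul_comm (1 ⊗ₜ[A] j _), mul_assoc,
          Algebra.TensorProduct.tmul_mul_tmul, one_mul, Algebra.smul_def, map_mul])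
  TensorProduct.liftAddHom
    { toFun := fun x =>
        { toFun := fun l => g l x
          map_zero' := by
            induction x using TensorProduct.induction_on with
            | zero => simp
            | tmul r b => simp [g]
            | add x y hx hy => rw [map_add, hx, hy, add_zero]
          map_add' := fun l l' => by
            induction x using TensorProduct.induction_on with
            | zero => simp
            | tmul r b => simp [g, add_mul]
            | add x y hx hy => rw [map_add, map_add, map_add, hx, hy]; abel }
      map_zero' := by ext; simp
      map_add' := fun x y => by ext; simp }
    (fun s x l => by
      change g l (s • x) = g (s • l) x
      induction x using TensorProduct.induction_on with
      | zero => simp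
      | tmul r b => simp [g, TensorProduct.smul_tmul', smul_smul, mul_comm]
      | add x y hx hy => rw [smul_add, map_add, map_add, hx, hy])

theorem RelCartierMap.extend_tmul (φ : RelCartierMap h e R L) {B C : Type u} [CommRing B]
    [CommRing C] [Algebra A B] [Algebra A C] (j : B →+* C)
    (hj : ∀ a, algebraMap A C a = j (algebraMap A B a) ^ p ^ e) (r : R) (b : B) (l : L) :
    φ.extend j hj ((r ⊗ₜ[A] b) ⊗ₜ[R] l) =
      Algebra.TensorProduct.map (AlgHom.id A R) (rootLift h e j hj) (φ.toFun (r • l)) *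
        (1 ⊗ₜ j b) := by
  simp [RelCartierMap.extend]

theorem RelCartierMap.extend_smul (φ : RelCartierMap h e R L) {B C : Type u} [CommRing B]
    [CommRing C] [Algebra A B] [Algebra A C] (j : B →+* C)
    (hj : ∀ a, algebraMap A C a = j (algebraMap A B a) ^ p ^ e) (r : R) (b : B)
    (y : (R ⊗[A] B) ⊗[R] L) :
    φ.extend j hj (((r ^ p ^ e) ⊗ₜ[A] b : R ⊗[A] B) • y) = (r ⊗ₜ j b) * φ.extend j hj y := by
  induction y using TensorProduct.induction_on with
  | zero => simp
  | add y z hy hz => rw [smul_add, map_add, map_add, hy, hz, mul_add]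
  | tmul x l =>
    induction x using TensorProduct.induction_on with
    | zero => simp
    | add y z hy hz => rw [TensorProduct.add_tmul, smul_add, map_add, map_add, hy, hz, mul_add]
    | tmul s c =>
      rw [TensorProduct.smul_tmul', smul_eq_mul, Algebra.TensorProduct.tmul_mul_tmul,
        extend_tmul, extend_tmul, mul_smul, φ.map_pow_smul, map_mul,
        Algebra.TensorProduct.map_tmul, map_one, map_mul, ← mul_assoc,
        mul_comm (_ ⊗ₜ[A] _) (Algebra.TensorProduct.map _ _ _),
        mul_comm (_ ⊗ₜ[A] _) (Algebra.TensorProduct.map _ _ _), mul_assoc, mul_assoc]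
      simp

theorem RelCartierMap.extend_pow_smul (φ : RelCartierMap h e R L) {B C : Type u} [CommRing B]
    [CommRing C] [Algebra A B] [Algebra A C] (j : B →+* C)
    (hj : ∀ a, algebraMap A C a = j (algebraMap A B a) ^ p ^ e) (r : R)
    (y : (R ⊗[A] B) ⊗[R] L) :
    φ.extend j hj (r ^ p ^ e • y) = r • φ.extend j hj y := by
  have h1 : r ^ p ^ e • y = ((r ^ p ^ e) ⊗ₜ[A] 1 : R ⊗[A] B) • y :=
    (algebraMap_smul (R ⊗[A] B) (r ^ p ^ e) y).symm
  rw [h1, extend_smul, map_one, Algebra.smul_def]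
  rfl

/-- `φ ⊗_{A^{1/p^e}} A^{1/p^{m+e}}`, as a map from `(R_{A^{1/p^m}} ⊗_R L)^{1/p^e}` to
`R_{A^{1/p^{m+e}}}`. -/
def RelCartierMap.twist (φ : RelCartierMap h e R L) (m : ℕ) :
    (R ⊗[A] RootRing h m) ⊗[R] L →+ R ⊗[A] RootRing h (m + e) :=
  φ.extend ((toRoot h (m + e)).toRingHom.comp (toRoot h m).symm.toRingHom) (fun a => by
    simp [algebraMap_root, pow_add, pow_mul])

/-- The `n`-fold composition
`φ^n : (L^{1 + q + ⋯ + q^{n-1}})^{1/q^n} → R_{A^{1/q^n}}` with `q = p^e`: the map `φ^{n+1}` is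
`(L ⊗_R (L^{1 + q + ⋯ + q^{n-1}})^{1/q^n})^{1/q} → (L ⊗_R R_{A^{1/q^n}})^{1/q} → R_{A^{1/q^{n+1}}}`,
the first arrow being `(id ⊗ φ^n)^{1/q}` and the second one `φ ⊗_{A^{1/q}} A^{1/q^{n+1}}`. -/
def RelCartierMap.pow (hR : (p : R) = 0) (φ : RelCartierMap h e R L) :
    (n : ℕ) → rootPower L (frob hR e) n →ₗ[R] R ⊗[A] RootRing h (e * n)
  | 0 => (Algebra.TensorProduct.includeLeft : R →ₐ[R] R ⊗[A] RootRing h (e * 0)).toLinearMap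
  | n + 1 =>
    let g : L ⊗[R] rootPower L (frob hR e) n →ₗ[R] (R ⊗[A] RootRing h (e * n)) ⊗[R] L :=
      (TensorProduct.comm R L (R ⊗[A] RootRing h (e * n))).toLinearMap ∘ₗ
        (LinearMap.lTensor L (φ.pow hR n))
    { toFun := fun y => φ.twist (e * n) (g y)
      map_add' := fun y z =>
        (congrArg (φ.twist (e * n)) (g.map_add y z)).trans (map_add _ _ _)
      map_smul' := fun r y =>
        (congrArg (φ.twist (e * n)) (g.map_smul (frob hR e r) y)).trans
          (φ.extend_pow_smul _ _ r _) }

/-- The `n`-th relative non-`F`-pure ideal `σ_n(X/V, φ) ⊆ R_{A^{1/p^{ne}}}` for `X = Spec R` and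
`V = Spec A`, the image of `φ^n`. (The image is already an ideal.) -/
def RelCartierMap.sigma (hR : (p : R) = 0) (φ : RelCartierMap h e R L) (n : ℕ) :
    Ideal (R ⊗[A] RootRing h (e * n)) :=
  Ideal.span (Set.range (φ.pow hR n))

/-! ### Base change -/

section BaseChange

attribute [local instance] Algebra.TensorProduct.rightAlgebra

variable {B : Type u} [CommRing B] [Algebra A B]

/-- The map `A^{1/p^m} → B^{1/p^m}`. -/
def rootMap (h : (p : A) = 0) (hB : (p : B) = 0) (m : ℕ) : RootRing h m →+* RootRing hB m :=
  ((toRoot hB m).toRingHom.comp (algebraMap A B)).comp (toRoot h m).symm.toRingHom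

/-- The map `R_{A^{1/p^m}} = R ⊗_A A^{1/p^m} → (R_B) ⊗_B B^{1/p^m} = (R_B)_{B^{1/p^m}}`. -/
def baseChangeMap (R : Type u) [CommRing R] [Algebra A R] (h : (p : A) = 0) (hB : (p : B) = 0)
    (m : ℕ) : R ⊗[A] RootRing h m →+* (R ⊗[A] B) ⊗[B] RootRing hB m :=
  Algebra.TensorProduct.mapRingHom (algebraMap A B) Algebra.TensorProduct.includeLeftRingHom
    (rootMap h hB m)
    (RingHom.ext fun a => Algebra.TensorProduct.tmul_one_eq_one_tmul a)
    (by ext a; simp [rootMap, algebraMap_root])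

/-- The base change `φ_B : (L_B)^{1/p^e} → (R_B)_{B^{1/p^e}}` of `φ` along `A → B`. -/
def RelCartierMap.baseChange (φ : RelCartierMap h e R L) (hB : (p : B) = 0) :
    RelCartierMap hB e (R ⊗[A] B) ((R ⊗[A] B) ⊗[R] L) :=
  let ν : R ⊗[A] RootRing hB e →+* (R ⊗[A] B) ⊗[B] RootRing hB e :=
    Algebra.TensorProduct.mapRingHom (algebraMap A B) Algebra.TensorProduct.includeLeftRingHom
      (RingHom.id _) (RingHom.ext fun a => Algebra.TensorProduct.tmul_one_eq_one_tmul a)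
      (by ext a; simp [algebraMap_root])
  have hj : ∀ a, algebraMap A (RootRing hB e) a
      = (toRoot hB e).toRingHom (algebraMap A B a) ^ p ^ e := fun a => by
    simp [algebraMap_root]
  have hS : (p : R ⊗[A] B) = 0 := natCast_eq_zero_of_ringHom (algebraMap B (R ⊗[A] B)) hB
  have hν (r : R) (b : B) :
      ν (r ⊗ₜ algebraMap B (RootRing hB e) b) = (r ⊗ₜ[A] b) ⊗ₜ[B] 1 := by
    have : (r ⊗ₜ[A] b : R ⊗[A] B) = b • (r ⊗ₜ[A] 1) := by
      rw [Algebra.smul_def]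
      change _ = (1 ⊗ₜ[A] b) * (r ⊗ₜ[A] 1)
      simp
    rw [this, TensorProduct.smul_tmul, Algebra.smul_def, mul_one]
    simp [ν]
  have key (x : R ⊗[A] B) (y : (R ⊗[A] B) ⊗[R] L) :
      ν (φ.extend (toRoot hB e).toRingHom hj (frob hS e x • y)) =
        (x ⊗ₜ 1) * ν (φ.extend (toRoot hB e).toRingHom hj y) := by
    induction x using TensorProduct.induction_on with
    | zero => simp
    | add x x' hx hx' => rw [map_add, add_smul, map_add, map_add, hx, hx', TensorProduct.add_tmul,
        add_mul]
    | tmul r b =>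
      have h1 : frob hS e (r ⊗ₜ[A] b) = (r ^ p ^ e) ⊗ₜ[A] (b ^ p ^ e) :=
        Algebra.TensorProduct.tmul_pow _ _ _
      rw [h1, extend_smul, map_mul ν, ← hν]
      rfl
  { toFun := ν.toAddMonoidHom.comp (φ.extend (toRoot hB e).toRingHom hj)
    map_pow_smul := key
    map_base_smul := fun b y => by
      have h1 : algebraMap B (R ⊗[A] B) b = ((1 : R) ^ p ^ e) ⊗ₜ[A] b := by
        rw [one_pow]
        rfl
      have h2 := congrArg ν (φ.extend_smul (toRoot hB e).toRingHom hj 1 b y)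
      rw [← h1, map_mul ν] at h2
      refine h2.trans ?_
      congr 1
      simp [ν, Algebra.TensorProduct.one_def] }

end BaseChange

/-! ### Perfect base fields -/

section Perfect

variable {K : Type u} [Field K] [CharP K p] [PerfectField K]

/-- For a perfect field `K` and a `K`-algebra `S`, the identification of
`S_{K^{1/p^m}} = S ⊗_K K^{1/p^m}` with `S`, through `K^{1/p^m} = K`. -/
def perfectIdent (hK : (p : K) = 0) (S : Type u) [CommRing S] [Algebra K S] (m : ℕ) :
    S ⊗[K] RootRing hK m →ₐ[S] S :=
  Algebra.TensorProduct.lift (AlgHom.id S S)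
    ((Algebra.ofId K S).comp ({ (iterateFrobeniusEquiv K p m).symm.toRingHom.comp (toRoot hK m).symm.toRingHom with
        commutes' := fun a => by
          exact (iterateFrobeniusEquiv K p m).symm_apply_apply a }))
    (fun _ _ => .all _ _)

/-- Over a perfect field `K`, a relative map `φ : M^{1/p^e} → S_{K^{1/p^e}}` is identified with
a `p^{-e}`-linear map `ψ : M^{1/p^e} → S`. -/
def RelCartierMap.toCartierMap {hK : (p : K) = 0} {S M : Type u} [CommRing S] [Algebra K S]
    [AddCommGroup M] [Module S M] (φ : RelCartierMap hK e S M) : CartierMap p e S M where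
  toFun := (perfectIdent hK S e).toRingHom.toAddMonoidHom.comp φ.toFun
  map_pow_smul s x := by
    simp [φ.map_pow_smul, perfectIdent]

end Perfect

/-! ### Restriction of `σ_n` to base changes and to perfect fibers -/

section Fiber

attribute [local instance] Algebra.TensorProduct.rightAlgebra

/-- The extension `σ_n(X/V, φ) · 𝒪_{X_{T^{ne}}}` for `T = Spec B → V = Spec A`, the ideal of
`(R_B)_{B^{1/p^{ne}}}` generated by the image of `σ_n(X/V, φ)`. -/
def RelCartierMap.sigmaExtended (hR : (p : R) = 0) (φ : RelCartierMap h e R L)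
    {B : Type u} [CommRing B] [Algebra A B] (hB : (p : B) = 0) (n : ℕ) :
    Ideal ((R ⊗[A] B) ⊗[B] RootRing hB (e * n)) :=
  (φ.sigma hR n).map (baseChangeMap R h hB (e * n))

/-- The relative non-`F`-pure ideal `σ_n(X_T/T, φ_T)` of the base change to `T = Spec B`. -/
def RelCartierMap.sigmaBaseChange (φ : RelCartierMap h e R L)
    {B : Type u} [CommRing B] [Algebra A B] (hB : (p : B) = 0) (n : ℕ) :
    Ideal ((R ⊗[A] B) ⊗[B] RootRing hB (e * n)) :=
  (φ.baseChange hB).sigma (natCast_eq_zero_of_ringHom (algebraMap B (R ⊗[A] B)) hB) n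

variable (K : Type u) [Field K] [CharP K p] [PerfectField K] [Algebra A K]

/-- For a perfect point `s = Spec K → V = Spec A`, the ideal `σ_n(X/V, φ) · 𝒪_{X_{s^{ne}}}`
as an ideal of `𝒪_{X_s} = R ⊗_A K`, through the identification of `X_{s^{ne}}` with `X_s`. -/
def RelCartierMap.sigmaOnFiber (hR : (p : R) = 0) (φ : RelCartierMap h e R L) (n : ℕ) :
    Ideal (R ⊗[A] K) :=
  (φ.sigmaExtended hR (CharP.cast_eq_zero K p) n).map
    (perfectIdent (CharP.cast_eq_zero K p) (R ⊗[A] K) (e * n))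

/-- The `p^{-e}`-linear map `ψ_s : (L_s)^{1/p^e} → 𝒪_{X_s}` induced by `φ` on the fiber over
a perfect point `s = Spec K → V = Spec A`: the base change `φ_s`, with `K^{1/p^e}` identified
with `K`. Here `L_s = 𝒪_{X_s} ⊗_R L`. -/
def RelCartierMap.fiberMap (φ : RelCartierMap h e R L) :
    CartierMap p e (R ⊗[A] K) ((R ⊗[A] K) ⊗[R] L) :=
  (φ.baseChange (CharP.cast_eq_zero K p)).toCartierMap

/-- The absolute non-`F`-pure ideal `σ(X_s, ψ_s)` of the fiber over a perfect point. -/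
def RelCartierMap.fiberSigma (φ : RelCartierMap h e R L) : Ideal (R ⊗[A] K) :=
  (φ.fiberMap K).sigma (natCast_eq_zero_of_ringHom (algebraMap K (R ⊗[A] K))
    (CharP.cast_eq_zero K p))

end Fiber

end Relative


/-! ## Frobenius morphisms of schemes -/

section Schemes

theorem natCast_section {p : ℕ} {X : Scheme.{u}} (hX : (p : Γ(X, ⊤)) = 0) (U : X.Opens) :
    (p : Γ(X, U)) = 0 :=
  natCast_eq_zero_of_ringHom (X.presheaf.map (homOfLE le_top).op).hom hX

theorem natCast_source {p : ℕ} {X V : Scheme.{u}} (f : X ⟶ V) (hV : (p : Γ(V, ⊤)) = 0) :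
    (p : Γ(X, ⊤)) = 0 :=
  natCast_eq_zero_of_ringHom f.appTop.hom hV

variable {p : ℕ} [Fact p.Prime]

/-- The `e`-th absolute Frobenius of a scheme of characteristic `p`: the identity on points,
and `x ↦ x ^ (p ^ e)` on functions. -/
def absFrobenius {X : Scheme.{u}} (hX : (p : Γ(X, ⊤)) = 0) (e : ℕ) : X ⟶ X where
  base := 𝟙 _
  c :=
    { app := fun U => CommRingCat.ofHom (frob (natCast_section hX U.unop) e)
      naturality := fun U V i => by
        ext x
        exact (map_pow (X.presheaf.map i).hom x (p ^ e)).symm }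
  prop := fun x => by
    constructor
    intro a ha
    obtain ⟨U, hxU, s, rfl⟩ := X.presheaf.exists_germ_eq a
    erw [PresheafedSpace.stalkMap_germ_apply] at ha
    have hq : p ^ e ≠ 0 := pow_ne_zero _ (Fact.out : p.Prime).ne_zero
    have h1 : IsUnit ((X.presheaf.germ U x hxU).hom s ^ p ^ e) := by
      rw [← map_pow]
      exact ha
    exact (isUnit_pow_iff hq).1 h1

theorem absFrobenius_appLE {X : Scheme.{u}} (hX : (p : Γ(X, ⊤)) = 0) (e : ℕ) (U U' : X.Opens)
    (hU : U' ≤ absFrobenius hX e ⁻¹ᵁ U) (x : Γ(X, U)) :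
    (absFrobenius hX e).appLE U U' hU x = X.presheaf.map (homOfLE hU).op (x ^ p ^ e) := rfl

variable {X V : Scheme.{u}} (f : X ⟶ V)

theorem absFrobenius_comp (hV : (p : Γ(V, ⊤)) = 0) (e : ℕ) :
    absFrobenius (natCast_source f hV) e ≫ f = f ≫ absFrobenius hV e := by
  refine Scheme.Hom.ext rfl fun U => ?_
  ext x
  have h1 : (X.presheaf.map (𝟙 (Opposite.op (f ⁻¹ᵁ U)))).hom ((f.app U).hom x ^ p ^ e) =
      (f.app U).hom (x ^ p ^ e) := by
    rw [X.presheaf.map_id, map_pow (f.app U).hom]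
    rfl
  exact h1

/-- The scheme `X_{V^e} = X ×_V V^e`, where `V^e` is `V` viewed over itself through the `e`-th
absolute Frobenius. -/
abbrev frobTwist (hV : (p : Γ(V, ⊤)) = 0) (e : ℕ) : Scheme.{u} :=
  pullback f (absFrobenius hV e)

/-- The `e`-th relative Frobenius `X^e → X_{V^e}`. -/
def relFrobenius (hV : (p : Γ(V, ⊤)) = 0) (e : ℕ) : X ⟶ frobTwist f hV e :=
  pullback.lift (absFrobenius (natCast_source f hV) e) f (absFrobenius_comp f hV e)

/-- An `𝒪_X`-module is a line bundle if it is locally isomorphic to `𝒪_X`. -/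
def IsLineBundle (L : X.Modules) : Prop :=
  ∀ x : X, ∃ U : X.Opens, x ∈ U ∧
    Nonempty (L.restrict U.ι ≅ (SheafOfModules.unit U.toScheme.ringCatSheaf : U.toScheme.Modules))

/-- The type of `𝒪_{X_{V^e}}`-linear maps `φ : L^{1/p^e} → 𝒪_{X_{V^e}}`, where `L^{1/p^e}` is the
direct image of `L` under the relative Frobenius. -/
def RelMap (hV : (p : Γ(V, ⊤)) = 0) (e : ℕ) (L : X.Modules) : Type u :=
  (Scheme.Modules.pushforward (relFrobenius f hV e)).obj L ⟶
    (SheafOfModules.unit (frobTwist f hV e).ringCatSheaf : (frobTwist f hV e).Modules)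

/-- Affine open sets `U ⊆ X` and `W ⊆ V` with `f(U) ⊆ W`. -/
structure Chart where
  /-- the open subset of `X` -/
  U : X.Opens
  /-- the open subset of `V` -/
  W : V.Opens
  affine_U : IsAffineOpen U
  affine_W : IsAffineOpen W
  le : U ≤ f ⁻¹ᵁ W

namespace Chart

variable {f} (c : Chart f)

/-- The ring `A = 𝒪_V(W)`. -/
def A : Type u := Γ(V, c.W)

/-- The ring `R = 𝒪_X(U)`. -/
def R : Type u := Γ(X, c.U)

instance : CommRing c.A := inferInstanceAs (CommRing Γ(V, c.W))
instance : CommRing c.R := inferInstanceAs (CommRing Γ(X, c.U))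
instance : Algebra c.A c.R := (f.appLE c.W c.U c.le).hom.toAlgebra

/-- The `R`-module `L(U)`. -/
def Sec (L : X.Modules) : Type u := Γ(L, c.U)

instance (L : X.Modules) : AddCommGroup (c.Sec L) := inferInstanceAs (AddCommGroup Γ(L, c.U))
instance (L : X.Modules) : Module c.R (c.Sec L) := inferInstanceAs (Module Γ(X, c.U) Γ(L, c.U))

end Chart

end Schemes

section Local

variable {X V : Scheme.{u}} {f : X ⟶ V}

namespace Chart

theorem natCast_A {p : ℕ} (c : Chart f) (hV : (p : Γ(V, ⊤)) = 0) : (p : c.A) = 0 :=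
  natCast_section hV c.W

theorem natCast_R {p : ℕ} (c : Chart f) (hV : (p : Γ(V, ⊤)) = 0) : (p : c.R) = 0 :=
  natCast_section (natCast_source f hV) c.U

variable {p : ℕ} [Fact p.Prime] (c : Chart f) (hV : (p : Γ(V, ⊤)) = 0) (e : ℕ)

/-- The affine open subset `U ×_W W^e` of `X_{V^e}`. -/
def twistOpen : (frobTwist f hV e).Opens :=
  pullback.fst f (absFrobenius hV e) ⁻¹ᵁ c.U ⊓ pullback.snd f (absFrobenius hV e) ⁻¹ᵁ c.W

/-- The map from `R` to the functions on `U ×_W W^e`. -/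
def twistFst : CommRingCat.of c.R ⟶ Γ(frobTwist f hV e, c.twistOpen hV e) :=
  (pullback.fst f (absFrobenius hV e)).appLE c.U (c.twistOpen hV e) inf_le_left

/-- The map from `A^{1/p^e}` to the functions on `U ×_W W^e`. -/
def twistSnd : CommRingCat.of (RootRing (c.natCast_A hV) e) ⟶
    Γ(frobTwist f hV e, c.twistOpen hV e) :=
  (pullback.snd f (absFrobenius hV e)).appLE c.W (c.twistOpen hV e) inf_le_right

theorem isPushout : IsPushout (CommRingCat.ofHom (algebraMap c.A c.R))
    (CommRingCat.ofHom (algebraMap c.A (RootRing (c.natCast_A hV) e)))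
    (c.twistFst hV e) (c.twistSnd hV e) := by
  have h1 : (absFrobenius hV e).appLE c.W c.W le_rfl =
      CommRingCat.ofHom (algebraMap c.A (RootRing (c.natCast_A hV) e)) := by
    ext x
    have h2 : (V.presheaf.map (𝟙 (Opposite.op c.W))).hom (x ^ p ^ e) = x ^ p ^ e := by
      rw [V.presheaf.map_id]
      rfl
    exact h2
  have h3 := h1 ▸ (isIso_pushoutSection_iff (.of_hasPullback f (absFrobenius hV e)) le_rfl c.le rfl).1
    (isIso_pushoutSection_of_isAffineOpen _ _ _ _ c.affine_W c.affine_W c.affine_U)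
  exact h3

/-- The isomorphism between `R_{A^{1/p^e}} = R ⊗_A A^{1/p^e}` and the ring of functions on
`U ×_W W^e`. -/
def twistEquiv : c.R ⊗[c.A] RootRing (c.natCast_A hV) e ≃+*
    Γ(frobTwist f hV e, c.twistOpen hV e) :=
  ((CommRingCat.isPushout_tensorProduct c.A c.R (RootRing (c.natCast_A hV) e)).isoIsPushout _ _
    (c.isPushout hV e)).commRingCatIsoToRingEquiv

theorem twistEquiv_left (r : c.R) : c.twistEquiv hV e (r ⊗ₜ 1) = c.twistFst hV e r :=
  congr($((CommRingCat.isPushout_tensorProduct c.A c.R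
    (RootRing (c.natCast_A hV) e)).inl_isoIsPushout_hom _ _ (c.isPushout hV e)) r)

theorem twistEquiv_right (a : RootRing (c.natCast_A hV) e) : c.twistEquiv hV e (1 ⊗ₜ a) =
    c.twistSnd hV e a :=
  congr($((CommRingCat.isPushout_tensorProduct c.A c.R
    (RootRing (c.natCast_A hV) e)).inr_isoIsPushout_hom _ _ (c.isPushout hV e)) a)

theorem preimage_twistOpen_le : relFrobenius f hV e ⁻¹ᵁ c.twistOpen hV e ≤ c.U := by
  have h1 : relFrobenius f hV e ≫ pullback.fst f (absFrobenius hV e) =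
    absFrobenius (natCast_source f hV) e := pullback.lift_fst _ _ _
  intro x hx
  have h2 : (relFrobenius f hV e ≫ pullback.fst f (absFrobenius hV e)) x ∈ c.U := hx.1
  rw [h1] at h2
  exact h2

theorem le_preimage_twistOpen : c.U ≤ relFrobenius f hV e ⁻¹ᵁ c.twistOpen hV e := by
  have h1 : relFrobenius f hV e ≫ pullback.fst f (absFrobenius hV e) =
    absFrobenius (natCast_source f hV) e := pullback.lift_fst _ _ _
  have h2 : relFrobenius f hV e ≫ pullback.snd f (absFrobenius hV e) = f :=
    pullback.lift_snd _ _ _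
  intro x hx
  refine ⟨?_, ?_⟩
  · change (relFrobenius f hV e ≫ pullback.fst f (absFrobenius hV e)) x ∈ c.U
    rw [h1]
    exact hx
  · change (relFrobenius f hV e ≫ pullback.snd f (absFrobenius hV e)) x ∈ c.W
    rw [h2]
    exact c.le hx

/-- The map `φ` on the affine open set `U ×_W W^e`, as an `R_{A^{1/p^e}}`-linear map
`L(U)^{1/p^e} → R_{A^{1/p^e}}`. -/
def localMap {L : X.Modules} (φ : RelMap f hV e L) :
    RelCartierMap (c.natCast_A hV) e c.R (c.Sec L) :=
  let ρ : Γ(L, c.U) →+ Γ(L, relFrobenius f hV e ⁻¹ᵁ c.twistOpen hV e) :=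
    (L.presheaf.map (homOfLE (c.preimage_twistOpen_le hV e)).op).hom
  let φ' : Γ(L, relFrobenius f hV e ⁻¹ᵁ c.twistOpen hV e) →+
      Γ(frobTwist f hV e, c.twistOpen hV e) :=
    (Scheme.Modules.Hom.app φ (c.twistOpen hV e)).hom
  have key (x : Γ(frobTwist f hV e, c.twistOpen hV e)) (r : Γ(X, c.U))
      (hx : (relFrobenius f hV e).app (c.twistOpen hV e) x =
        X.presheaf.map (homOfLE (c.preimage_twistOpen_le hV e)).op r) (l : Γ(L, c.U)) :
      φ' (ρ (r • l)) = x * φ' (ρ l) := by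
    have h1 : ρ (r • l) = (relFrobenius f hV e).app (c.twistOpen hV e) x • ρ l :=
      (Scheme.Modules.map_smul L _ r l).trans (by rw [hx])
    rw [h1]
    exact Scheme.Modules.Hom.app_smul φ x _
  { toFun := (c.twistEquiv hV e).symm.toRingHom.toAddMonoidHom.comp (φ'.comp ρ)
    map_pow_smul := fun r l => by
      have h1 : relFrobenius f hV e ≫ pullback.fst f (absFrobenius hV e) =
        absFrobenius (natCast_source f hV) e := pullback.lift_fst _ _ _
      have h2 := key (c.twistFst hV e r) (r ^ p ^ e) (by
        have h3 := Scheme.Hom.appLE_comp_appLE (relFrobenius f hV e)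
          (pullback.fst f (absFrobenius hV e)) c.U (c.twistOpen hV e)
          (relFrobenius f hV e ⁻¹ᵁ c.twistOpen hV e) inf_le_left le_rfl
        rw [Scheme.Hom.appLE_eq_app] at h3
        refine congr($h3 r).trans ?_
        simp only [h1]
        rfl) l
      change (c.twistEquiv hV e).symm (φ' (ρ _)) = _ * (c.twistEquiv hV e).symm (φ' (ρ _))
      refine (congrArg _ h2).trans ?_
      rw [map_mul, ← c.twistEquiv_left, RingEquiv.symm_apply_apply]
    map_base_smul := fun a l => by
      have h1 : relFrobenius f hV e ≫ pullback.snd f (absFrobenius hV e) = f :=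
        pullback.lift_snd _ _ _
      have h2 := key (c.twistSnd hV e (toRoot (c.natCast_A hV) e a)) (algebraMap c.A c.R a) (by
        have h3 := Scheme.Hom.appLE_comp_appLE (relFrobenius f hV e)
          (pullback.snd f (absFrobenius hV e)) c.W (c.twistOpen hV e)
          (relFrobenius f hV e ⁻¹ᵁ c.twistOpen hV e) inf_le_right le_rfl
        rw [Scheme.Hom.appLE_eq_app] at h3
        refine congr($h3 a).trans ?_
        simp only [h1]
        exact congr($(Scheme.Hom.appLE_map f c.le
          (homOfLE (c.preimage_twistOpen_le hV e)).op) a).symm) l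
      change (c.twistEquiv hV e).symm (φ' (ρ _)) = _ * (c.twistEquiv hV e).symm (φ' (ρ _))
      refine (congrArg _ h2).trans ?_
      rw [map_mul, ← c.twistEquiv_right, RingEquiv.symm_apply_apply] }

/-- The `A`-algebra structure on `𝒪_T(O)`, for a morphism `g : T → V` and an open set `O`
of `T` that maps to `W`. -/
abbrev baseAlgebra {T : Scheme.{u}} (g : T ⟶ V) (O : T.Opens) (hO : O ≤ g ⁻¹ᵁ c.W) :
    Algebra c.A Γ(T, O) :=
  (g.appLE c.W O hO).hom.toAlgebra

/-- The `A`-algebra structure on `K`, for a point `s : Spec K → V` that maps to `W`. -/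
abbrev pointAlgebra {K : Type u} [Field K] (s : Spec (.of K) ⟶ V) (hs : ⊤ ≤ s ⁻¹ᵁ c.W) :
    Algebra c.A K :=
  (s.appLE c.W ⊤ hs ≫ (Scheme.ΓSpecIso (.of K)).hom).hom.toAlgebra

end Chart

end Local

end
end RelFPure

/-!
The ideal `σ_{n+1}` is the image of `σ_n` under an operation on ideals, "apply the twist of `φ` to
`L ⊗ I`", which has an adjoint and therefore commutes with base change. Induction on `n` gives (2);
the same argument over a perfect field `K` identifies the extension of `σ_n` to the fiber over
`Spec K` with the image `I_n` of the `n`-fold composition of `ψ_s`. So (1) asks for one `N` such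
that `I_N = I_{N+1}` on all perfect fibers, since the sequence `I_n` is constant from there on.

On a single fiber the colon ideals `(I_{n+1} : I_n)` increase with `n`, hence are eventually equal
to some ideal `J`. If `J ≠ ⊤`, localize at a minimal prime of `J`: some power of `J` multiplies
`I_N` into every `I_n`, so the images can be compared inside a module of finite length, and they
stabilize there, which contradicts the choice of the prime.

For a prime `P` of the coordinate ring `A` of the base, let `D` be the perfect closure of `A/P`. The
images stabilize on the fiber over the fraction field of `D`, and clearing denominators shows that
they stabilize at the same step over all perfect points of a nonempty open subset of `V(P)`.
Noetherian induction makes the step uniform over `Spec A`. It is uniform over all charts because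
the images commute with localization, so that stabilization is local on `X`.
-/

namespace RelFPure

noncomputable section

/-! ### Images of the iterates of a Cartier map -/

section Stabilization

variable {R N : Type*} [CommRing R] [AddCommGroup N] [Module R N]

theorem exists_mem_submonoid_colon (T : Submonoid R) {N₁ N₂ : Submodule R N} (hN₁ : N₁.FG)
    (h : ∀ x ∈ N₁, ∃ s ∈ T, s • x ∈ N₂) : ∃ s ∈ T, s ∈ N₂.colon (N₁ : Set N) := by
  induction N₁, hN₁ using Submodule.fg_induction with
  | singleton x =>
    obtain ⟨s, hs, hsx⟩ := h x (Submodule.mem_span_singleton_self x)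
    exact ⟨s, hs, Submodule.mem_colon_span_singleton.2 hsx⟩
  | sup P Q _ _ ihP ihQ =>
    obtain ⟨s, hs, hsP⟩ := ihP fun x hx => h x (le_sup_left (a := P) hx)
    obtain ⟨t, ht, htQ⟩ := ihQ fun x hx => h x (le_sup_right (a := P) hx)
    refine ⟨s * t, mul_mem hs ht, Submodule.mem_colon.2 fun x hx => ?_⟩
    obtain ⟨y, hy, z, hz, rfl⟩ := Submodule.mem_sup.1 hx
    rw [smul_add, mul_smul, mul_smul, smul_comm s t y]
    exact add_mem (N₂.smul_mem t (Submodule.mem_colon.1 hsP y hy))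
      (N₂.smul_mem s (Submodule.mem_colon.1 htQ z hz))

theorem exists_mem_submonoid_colon_of_map_le (T : Submonoid R) {S : Type*} [CommRing S]
    [Algebra R S] [IsLocalization T S] {I J : Ideal R} (hI : I.FG)
    (h : I.map (algebraMap R S) ≤ J.map (algebraMap R S)) : ∃ s ∈ T, s ∈ J.colon (I : Set R) :=
  exists_mem_submonoid_colon T hI fun x hx =>
    (IsLocalization.algebraMap_mem_map_algebraMap_iff T S J x).1 (h (Ideal.mem_map_of_mem _ hx))

theorem map_le_map_of_mem_colon {S : Type*} [CommRing S] (f : R →+* S) {I J : Ideal R} {s : R}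
    (hs : s ∈ J.colon (I : Set R)) (hfs : IsUnit (f s)) : I.map f ≤ J.map f :=
  Ideal.map_le_iff_le_comap.2 fun x hx => (Ideal.unit_mul_mem_iff_mem _ hfs).1 <| by
    rw [← map_mul]
    exact Ideal.mem_map_of_mem f (Submodule.mem_colon.1 hs x hx)

theorem exists_le_succ_of_isArtinianRing_quotient [Module.Finite R N] (a : Ideal R)
    [IsArtinianRing (R ⧸ a)] {I : ℕ → Submodule R N} (hI : Antitone I)
    (ha : ∀ n, a • (⊤ : Submodule R N) ≤ I n) : ∃ n, I n ≤ I (n + 1) := by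
  let Q := N ⧸ (a • ⊤ : Submodule R N)
  have : Module.Finite (R ⧸ a) Q := .of_restrictScalars_finite R _ _
  have : IsArtinian R Q :=
    isArtinian_of_surjective_algebraMap (R := R ⧸ a) Ideal.Quotient.mk_surjective
  let J : ℕ →o (Submodule R Q)ᵒᵈ :=
    ⟨fun n => .toDual ((I n).map (a • ⊤ : Submodule R N).mkQ),
      fun _ _ hmn => Submodule.map_mono (hI hmn)⟩
  obtain ⟨n, hn⟩ := IsArtinian.monotone_stabilizes J
  have hcomap (k : ℕ) : ((I k).map (a • ⊤ : Submodule R N).mkQ).comap (Submodule.mkQ _) = I k := by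
    rw [Submodule.comap_map_mkQ, sup_eq_right.2 (ha k)]
  refine ⟨n, ?_⟩
  rw [← hcomap n, ← hcomap (n + 1)]
  exact Submodule.comap_mono (hn (n + 1) n.le_succ).ge

end Stabilization

namespace CartierMap

section Images

variable {p e : ℕ} {S M : Type u} [CommRing S] [AddCommGroup M] [Module S M]
  (ψ : CartierMap p e S M)

/-- The ideal `ψ(I M)`. -/
def mapIdeal (I : Ideal S) : Ideal S :=
  Ideal.span {s | ∃ a ∈ I, ∃ m, ψ.toFun (a • m) = s}

/-- The largest ideal `I` with `ψ(I M) ⊆ J`. -/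
def comapIdeal (J : Ideal S) : Ideal S where
  carrier := {a | ∀ m, ψ.toFun (a • m) ∈ J}
  zero_mem' m := by simp
  add_mem' ha hb m := by
    rw [add_smul, map_add]
    exact add_mem (ha m) (hb m)
  smul_mem' c a ha m := by
    rw [smul_eq_mul, mul_comm, mul_smul]
    exact ha (c • m)

theorem apply_smul_mem_mapIdeal {I : Ideal S} {a : S} (ha : a ∈ I) (m : M) :
    ψ.toFun (a • m) ∈ ψ.mapIdeal I :=
  Ideal.subset_span ⟨a, ha, m, rfl⟩

theorem gc_mapIdeal_comapIdeal : GaloisConnection ψ.mapIdeal ψ.comapIdeal := fun I J =>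
  ⟨fun h _ ha m => h (ψ.apply_smul_mem_mapIdeal ha m), fun h => Ideal.span_le.2 <| by
    rintro _ ⟨a, ha, m, rfl⟩
    exact h ha m⟩

theorem mapIdeal_mono : Monotone ψ.mapIdeal := ψ.gc_mapIdeal_comapIdeal.monotone_l

theorem mul_mem_mapIdeal {s : S} {I J : Ideal S} (hs : ∀ a ∈ I, s ^ p ^ e * a ∈ J) {x : S}
    (hx : x ∈ ψ.mapIdeal I) : s * x ∈ ψ.mapIdeal J := by
  suffices ψ.mapIdeal I ≤ (ψ.mapIdeal J).colon {s} by
    simpa [mul_comm] using Submodule.mem_colon_singleton.1 (this hx)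
  refine (ψ.gc_mapIdeal_comapIdeal _ _).2 fun a ha m => Submodule.mem_colon_singleton.2 ?_
  rw [smul_eq_mul, mul_comm, ← ψ.map_pow_smul, smul_smul]
  exact ψ.apply_smul_mem_mapIdeal (hs a ha) m

/-- The ideal `ψ^n((M^{1 + q + ⋯ + q^{n-1}})^{1/q^n})`, by the recursion
`ψ^{n+1}(M^{1 + q + ⋯ + q^n}) = ψ(ψ^n(M^{1 + q + ⋯ + q^{n-1}}) M)`. -/
def iterImage (n : ℕ) : Ideal S := ψ.mapIdeal^[n] ⊤

theorem iterImage_zero : ψ.iterImage 0 = ⊤ := rfl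

theorem iterImage_succ (n : ℕ) : ψ.iterImage (n + 1) = ψ.mapIdeal (ψ.iterImage n) :=
  Function.iterate_succ_apply' _ _ _

theorem iterImage_antitone : Antitone ψ.iterImage :=
  ψ.mapIdeal_mono.antitone_iterate_of_map_le le_top

theorem iterImage_eq_of_le_succ {N : ℕ} (hN : ψ.iterImage N ≤ ψ.iterImage (N + 1)) {n : ℕ}
    (hn : N ≤ n) : ψ.iterImage n = ψ.iterImage N := by
  induction n, hn using Nat.le_induction with
  | base => rfl
  | succ n hn ih =>
    rw [iterImage_succ, ih, ← iterImage_succ]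
    exact (ψ.iterImage_antitone N.le_succ).antisymm hN

theorem iterImage_le_succ_of_le {N : ℕ} (hN : ψ.iterImage N ≤ ψ.iterImage (N + 1)) {n : ℕ}
    (hn : N ≤ n) : ψ.iterImage n ≤ ψ.iterImage (n + 1) :=
  ((ψ.iterImage_eq_of_le_succ hN hn).trans
    (ψ.iterImage_eq_of_le_succ hN (hn.trans n.le_succ)).symm).le

theorem range_pow [Fact p.Prime] (h : (p : S) = 0) (n : ℕ) :
    LinearMap.range (ψ.pow h n) = ψ.iterImage n := by
  induction n with
  | zero => exact LinearMap.range_id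
  | succ n ih =>
    rw [iterImage_succ, ← ih]
    apply le_antisymm
    · rintro _ ⟨y, rfl⟩
      change M ⊗[S] rootPower M (frob h e) n at y
      induction y using TensorProduct.induction_on with
      | zero => exact (map_zero (ψ.pow h (n + 1))).symm ▸ zero_mem _
      | tmul m y => exact ψ.apply_smul_mem_mapIdeal (LinearMap.mem_range_self _ y) m
      | add x y hx hy => exact (map_add (ψ.pow h (n + 1)) x y).symm ▸ add_mem hx hy
    · refine (ψ.gc_mapIdeal_comapIdeal _ _).2 ?_
      rintro _ ⟨y, rfl⟩ m
      exact ⟨(m ⊗ₜ[S] y : M ⊗[S] rootPower M (frob h e) n), rfl⟩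

theorem sigma_eq_iterImage [Fact p.Prime] (h : (p : S) = 0) {N : ℕ}
    (hN : ψ.iterImage N ≤ ψ.iterImage (N + 1)) {n : ℕ} (hn : N ≤ n) :
    ψ.sigma h = ψ.iterImage n := by
  simp_rw [CartierMap.sigma, range_pow]
  refine (iInf_le _ n).antisymm (le_iInf fun k => ?_)
  rcases le_total k n with hk | hk
  · exact ψ.iterImage_antitone hk
  · rw [ψ.iterImage_eq_of_le_succ hN hn, ψ.iterImage_eq_of_le_succ hN (hn.trans hk)]

end Images

section HartshorneSpeiserLyubeznikGabber

variable {p e : ℕ} {S M : Type u} [CommRing S] [AddCommGroup M] [Module S M]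
  (ψ : CartierMap p e S M)

/-- The colon ideal `(ψ^{n+1} : ψ^n)` of two consecutive images. It cuts out the points of
`Spec S` at which the images have not stabilized at step `n`. -/
def iterColon (n : ℕ) : Ideal S := (ψ.iterImage (n + 1)).colon (ψ.iterImage n : Set S)

theorem mem_iterColon {n : ℕ} {s : S} :
    s ∈ ψ.iterColon n ↔ ∀ x ∈ ψ.iterImage n, s * x ∈ ψ.iterImage (n + 1) :=
  Submodule.mem_colon

variable [Fact p.Prime]

theorem iterColon_monotone : Monotone ψ.iterColon :=
  monotone_nat_of_le_succ fun n s hs => ψ.mem_iterColon.2 fun x hx => by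
    rw [iterImage_succ] at hx ⊢
    refine ψ.mul_mem_mapIdeal (fun a ha => ?_) hx
    obtain ⟨k, hk⟩ : s ∣ s ^ p ^ e := dvd_pow_self s (pow_ne_zero e (Fact.out : p.Prime).ne_zero)
    rw [hk, mul_comm s k, mul_assoc]
    exact Ideal.mul_mem_left _ k (ψ.mem_iterColon.1 hs a ha)

theorem sq_mem_colon_of_mem_iterColon (he : 0 < e) {N : ℕ} {s : S} (hs : s ∈ ψ.iterColon N)
    {n : ℕ} (hn : N ≤ n) : s ^ 2 ∈ (ψ.iterImage n).colon (ψ.iterImage N : Set S) := by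
  induction n, hn using Nat.le_induction with
  | base => exact Submodule.mem_colon.2 fun x hx => Ideal.mul_mem_left _ _ hx
  | succ n _ ih =>
    refine Submodule.mem_colon.2 fun x hx => ?_
    have hsx : s * x ∈ ψ.mapIdeal (ψ.iterImage N) :=
      ψ.iterImage_succ N ▸ ψ.mem_iterColon.1 hs x hx
    rw [smul_eq_mul, pow_two, mul_assoc, iterImage_succ]
    -- `s` acts on an image under `ψ` as `s ^ p ^ e`, which is a multiple of `s ^ 2`.
    refine ψ.mul_mem_mapIdeal (fun a ha => ?_) hsx
    obtain ⟨k, hk⟩ : s ^ 2 ∣ s ^ p ^ e :=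
      pow_dvd_pow s ((Fact.out : p.Prime).two_le.trans (Nat.le_self_pow he.ne' p))
    rw [hk, mul_comm _ k, mul_assoc]
    exact Ideal.mul_mem_left _ k (Submodule.mem_colon.1 ih a ha)

variable [IsNoetherianRing S]

theorem exists_iterColon_pow_le_colon (he : 0 < e) (N : ℕ) :
    ∃ k ≠ 0, ∀ n ≥ N, ψ.iterColon N ^ k ≤ (ψ.iterImage n).colon (ψ.iterImage N : Set S) := by
  obtain ⟨k, hk⟩ : ∃ k, ψ.iterColon N ^ k ≤
      ⨅ n ≥ N, (ψ.iterImage n).colon (ψ.iterImage N : Set S) := by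
    refine Ideal.exists_pow_le_of_le_radical_of_fg (fun s hs => ⟨2, ?_⟩) (IsNoetherian.noetherian _)
    simpa only [Submodule.mem_iInf] using fun n => ψ.sq_mem_colon_of_mem_iterColon he hs
  exact ⟨k + 1, k.succ_ne_zero, fun n hn =>
    ((Ideal.pow_le_pow_right k.le_succ).trans hk).trans (iInf₂_le n hn)⟩

theorem exists_map_iterImage_le_succ (he : 0 < e) {N : ℕ} {P : Ideal S} [P.IsPrime]
    (hP : P ∈ (ψ.iterColon N).minimalPrimes) :
    ∃ n ≥ N, (ψ.iterImage n).map (algebraMap S (Localization.AtPrime P)) ≤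
      (ψ.iterImage (n + 1)).map (algebraMap S (Localization.AtPrime P)) := by
  let T := Localization.AtPrime P
  obtain ⟨k, hk0, hk⟩ := ψ.exists_iterColon_pow_le_colon he N
  let a := (ψ.iterColon N ^ k).map (algebraMap S T)
  have : IsArtinianRing (T ⧸ a) := by
    refine IsLocalRing.quotient_artinian_of_mem_minimalPrimes_of_isLocalRing a ?_
    rw [IsLocalization.minimalPrimes_map P.primeCompl T, Set.mem_preimage,
      Localization.AtPrime.under_maximalIdeal, ← Ideal.radical_minimalPrimes,
      Ideal.radical_pow _ hk0, Ideal.radical_minimalPrimes]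
    exact hP
  let J (n : ℕ) := (ψ.iterImage (N + n)).map (algebraMap S T)
  have hJ : Antitone J := fun m n hmn =>
    Ideal.map_mono (ψ.iterImage_antitone (Nat.add_le_add_left hmn N))
  have ha (n : ℕ) : a * J 0 ≤ J n := by
    rw [← Ideal.map_mul]
    refine Ideal.map_mono (Ideal.mul_le.2 fun r hr s hs => ?_)
    exact Submodule.mem_colon.1 (hk (N + n) (N.le_add_right n) hr) s hs
  obtain ⟨n, hn⟩ := exists_le_succ_of_isArtinianRing_quotient a (N := J 0)
    (I := fun n => (J n).submoduleOf (J 0)) (fun _ _ h => Submodule.comap_mono (hJ h)) fun n => by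
      rw [Submodule.smul_le]
      exact fun r hr x _ => ha n (Ideal.mul_mem_mul hr x.2)
  exact ⟨N + n, N.le_add_right n, fun x hx => @hn ⟨x, hJ n.zero_le hx⟩ hx⟩

/-- The Hartshorne–Speiser–Lyubeznik–Gabber theorem. -/
theorem exists_iterImage_le_succ (he : 0 < e) :
    ∃ N, ψ.iterImage N ≤ ψ.iterImage (N + 1) := by
  obtain ⟨N, hN⟩ := monotone_stabilizes_iff_noetherian.2 (inferInstanceAs (IsNoetherian S S))
    ⟨ψ.iterColon, ψ.iterColon_monotone⟩
  suffices ψ.iterColon N = ⊤ from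
    ⟨N, fun x hx => by simpa using ψ.mem_iterColon.1 (this ▸ trivial : (1 : S) ∈ _) x hx⟩
  by_contra htop
  obtain ⟨P, hP⟩ := Ideal.nonempty_minimalPrimes htop
  have hPprime : P.IsPrime := hP.1.1
  obtain ⟨n, hn, hle⟩ := ψ.exists_map_iterImage_le_succ he hP
  obtain ⟨s, hsP, hs⟩ := exists_mem_submonoid_colon_of_map_le P.primeCompl
    (IsNoetherian.noetherian (ψ.iterImage n)) hle
  have hsN : s ∈ ψ.iterColon N := (hN n hn).symm.le hs
  exact hsP (hP.1.2 hsN)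

end HartshorneSpeiserLyubeznikGabber

end CartierMap

/-! ### Base change of the images of a relative Cartier map -/

section RelativeImages

theorem map_iterateFrobeniusEquiv_symm {p : ℕ} {D D' : Type*} [CommRing D] [ExpChar D p]
    [PerfectRing D p] [CommRing D'] [ExpChar D' p] [PerfectRing D' p] (g : D →+* D') (m : ℕ)
    (d : D) : g ((iterateFrobeniusEquiv D p m).symm d) =
      (iterateFrobeniusEquiv D' p m).symm (g d) := by
  rw [RingEquiv.eq_symm_apply, iterateFrobeniusEquiv_def, ← map_pow, ← iterateFrobeniusEquiv_def,
    RingEquiv.apply_symm_apply]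

variable {p : ℕ} [Fact p.Prime] {A : Type u} [CommRing A] {h : (p : A) = 0} {R : Type u}
  [CommRing R] [Algebra A R]

theorem ringHom_ext_tmul_toRoot {m : ℕ} {S : Type*} [CommRing S] {f g : R ⊗[A] RootRing h m →+* S}
    (hfg : ∀ r a, f (r ⊗ₜ toRoot h m a) = g (r ⊗ₜ toRoot h m a)) : f = g :=
  RingHom.ext fun x => by
    induction x using TensorProduct.induction_on with
    | zero => rw [map_zero, map_zero]
    | add x y hx hy => rw [map_add, map_add, hx, hy]
    | tmul r a =>
      obtain ⟨a, rfl⟩ := (toRoot h m).surjective a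
      exact hfg r a

/-- The map `R_{A^{1/p^e}} → R_{A^{1/p^{m+e}}}` along which `φ` is extended to `φ.twist m`. -/
def rootInclusion (R : Type u) [CommRing R] [Algebra A R] (h : (p : A) = 0) (e m : ℕ) :
    R ⊗[A] RootRing h e →ₐ[A] R ⊗[A] RootRing h (m + e) :=
  Algebra.TensorProduct.map (AlgHom.id A R)
    (rootLift h e ((toRoot h (m + e)).toRingHom.comp (toRoot h m).symm.toRingHom) fun a => by
      simp [algebraMap_root, pow_add, pow_mul])

theorem rootInclusion_tmul (e m : ℕ) (r : R) (a : A) :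
    rootInclusion R h e m (r ⊗ₜ toRoot h e a) = r ⊗ₜ toRoot h (m + e) (a ^ p ^ m) := rfl

namespace RelCartierMap

variable {e : ℕ} {L : Type u} [AddCommGroup L] [Module R L] (φ : RelCartierMap h e R L)

theorem twist_tmul (m : ℕ) (r : R) (a : A) (l : L) :
    φ.twist m ((r ⊗ₜ[A] toRoot h m a) ⊗ₜ[R] l) =
      rootInclusion R h e m (φ.toFun (r • l)) * (1 ⊗ₜ toRoot h (m + e) a) :=
  φ.extend_tmul _ _ r (toRoot h m a) l

theorem twist_tmul_mul (m : ℕ) (r : R) (a : A) (x : R ⊗[A] RootRing h m) (l : L) :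
    φ.twist m (((r ⊗ₜ toRoot h m a) * x) ⊗ₜ[R] l) =
      (1 ⊗ₜ toRoot h (m + e) a) * φ.twist m (x ⊗ₜ[R] (r • l)) := by
  have hext := φ.extend_smul ((toRoot h (m + e)).toRingHom.comp (toRoot h m).symm.toRingHom)
    (fun a => by simp [algebraMap_root, pow_add, pow_mul]) 1 (toRoot h m a) (x ⊗ₜ[R] (r • l))
  have hmul : (r ⊗ₜ[A] toRoot h m a) * x = r • ((1 ⊗ₜ toRoot h m a) * x) := by
    rw [← smul_mul_assoc, TensorProduct.smul_tmul', smul_eq_mul, mul_one]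
  rw [one_pow, TensorProduct.smul_tmul', smul_eq_mul] at hext
  rw [hmul, TensorProduct.smul_tmul]
  exact hext

/-- The ideal of `R_{A^{1/p^{m+e}}}` generated by the image of `(L ⊗ I)^{1/p^e}` under
`φ.twist m`, for an ideal `I` of `R_{A^{1/p^m}}`. -/
def twistIdeal (m : ℕ) (I : Ideal (R ⊗[A] RootRing h m)) : Ideal (R ⊗[A] RootRing h (m + e)) :=
  Ideal.span {y | ∃ x ∈ I, ∃ l, φ.twist m (x ⊗ₜ l) = y}

/-- The largest ideal `I` of `R_{A^{1/p^m}}` such that `φ.twist m` maps `(L ⊗ I)^{1/p^e}` to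
`J`. -/
def twistComap (m : ℕ) (J : Ideal (R ⊗[A] RootRing h (m + e))) :
    Ideal (R ⊗[A] RootRing h m) where
  carrier := {x | ∀ l, φ.twist m (x ⊗ₜ l) ∈ J}
  zero_mem' l := by simp
  add_mem' hx hy l := by
    rw [TensorProduct.add_tmul, map_add]
    exact add_mem (hx l) (hy l)
  smul_mem' c x hx := by
    induction c using TensorProduct.induction_on with
    | zero => simp
    | add c d hc hd =>
      intro l
      rw [add_smul, TensorProduct.add_tmul, map_add]
      exact add_mem (hc l) (hd l)
    | tmul r a =>
      intro l
      obtain ⟨a, rfl⟩ := (toRoot h m).surjective a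
      rw [smul_eq_mul, twist_tmul_mul]
      exact Ideal.mul_mem_left _ _ (hx (r • l))

theorem twist_mem_twistIdeal {m : ℕ} {I : Ideal (R ⊗[A] RootRing h m)} {x : R ⊗[A] RootRing h m}
    (hx : x ∈ I) (l : L) : φ.twist m (x ⊗ₜ l) ∈ φ.twistIdeal m I :=
  Ideal.subset_span ⟨x, hx, l, rfl⟩

theorem gc_twistIdeal_twistComap (m : ℕ) :
    GaloisConnection (φ.twistIdeal m) (φ.twistComap m) := fun I J =>
  ⟨fun h _ hx l => h (φ.twist_mem_twistIdeal hx l), fun h => Ideal.span_le.2 <| by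
    rintro _ ⟨x, hx, l, rfl⟩
    exact h hx l⟩

theorem sigma_zero (hR : (p : R) = 0) : φ.sigma hR 0 = ⊤ :=
  (Ideal.eq_top_iff_one _).2 (Ideal.subset_span ⟨(1 : R), rfl⟩)

theorem sigma_succ (hR : (p : R) = 0) (n : ℕ) :
    φ.sigma hR (n + 1) = φ.twistIdeal (e * n) (φ.sigma hR n) := by
  apply le_antisymm
  · refine Ideal.span_le.2 ?_
    rintro _ ⟨y, rfl⟩
    change L ⊗[R] rootPower L (frob hR e) n at y
    induction y using TensorProduct.induction_on with
    | zero => exact (map_zero (φ.pow hR (n + 1))).symm ▸ zero_mem _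
    | add x y hx hy => exact (map_add (φ.pow hR (n + 1)) x y).symm ▸ add_mem hx hy
    | tmul l y =>
      exact φ.twist_mem_twistIdeal (I := φ.sigma hR n) (Ideal.subset_span (Set.mem_range_self y)) l
  · refine (φ.gc_twistIdeal_twistComap _ _ _).2 (Ideal.span_le.2 ?_)
    rintro _ ⟨y, rfl⟩ l
    exact Ideal.subset_span ⟨(l ⊗ₜ[R] y : L ⊗[R] rootPower L (frob hR e) n), rfl⟩

end RelCartierMap

section BaseChange

attribute [local instance] Algebra.TensorProduct.rightAlgebra

variable {B : Type u} [CommRing B] [Algebra A B] (hB : (p : B) = 0) {e : ℕ}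

theorem baseChangeMap_tmul (m : ℕ) (r : R) (a : A) :
    baseChangeMap R h hB m (r ⊗ₜ toRoot h m a) =
      (r ⊗ₜ 1) ⊗ₜ toRoot hB m (algebraMap A B a) := by
  simp [baseChangeMap, rootMap]

theorem baseChangeMap_rootInclusion (m : ℕ) (x : R ⊗[A] RootRing h e) :
    baseChangeMap R h hB (m + e) (rootInclusion R h e m x) =
      rootInclusion (R ⊗[A] B) hB e m (baseChangeMap R h hB e x) := by
  suffices (baseChangeMap R h hB (m + e)).comp (rootInclusion R h e m).toRingHom =
      (rootInclusion (R ⊗[A] B) hB e m).toRingHom.comp (baseChangeMap R h hB e) from congr($this x)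
  refine ringHom_ext_tmul_toRoot fun r a => ?_
  change baseChangeMap R h hB (m + e) (rootInclusion R h e m (r ⊗ₜ toRoot h e a)) =
    rootInclusion (R ⊗[A] B) hB e m (baseChangeMap R h hB e (r ⊗ₜ toRoot h e a))
  rw [rootInclusion_tmul, baseChangeMap_tmul, baseChangeMap_tmul, rootInclusion_tmul, map_pow]

namespace RelCartierMap

variable {L : Type u} [AddCommGroup L] [Module R L] (φ : RelCartierMap h e R L)

theorem baseChange_tmul (r : R) (b : B) (l : L) :
    (φ.baseChange hB).toFun ((r ⊗ₜ[A] b) ⊗ₜ[R] l) =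
      baseChangeMap R h hB e (φ.toFun (r • l)) * (1 ⊗ₜ toRoot hB e b) := by
  have hj (a : A) : algebraMap A (RootRing hB e) a =
      (toRoot hB e).toRingHom (algebraMap A B a) ^ p ^ e := by simp [algebraMap_root]
  let θ := Algebra.TensorProduct.map (AlgHom.id A R) (rootLift h e (toRoot hB e).toRingHom hj)
  let ν : R ⊗[A] RootRing hB e →+* (R ⊗[A] B) ⊗[B] RootRing hB e :=
    Algebra.TensorProduct.mapRingHom (algebraMap A B) Algebra.TensorProduct.includeLeftRingHom
      (RingHom.id _) (RingHom.ext fun a => Algebra.TensorProduct.tmul_one_eq_one_tmul a)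
      (by ext a; simp [algebraMap_root])
  have hν : ν.comp θ.toRingHom = baseChangeMap R h hB e :=
    ringHom_ext_tmul_toRoot fun r a => by
      rw [baseChangeMap_tmul]
      simp [θ, ν, rootLift_toRoot]
  change ν (φ.extend (toRoot hB e).toRingHom hj ((r ⊗ₜ[A] b) ⊗ₜ[R] l)) = _
  rw [φ.extend_tmul, map_mul]
  exact congrArg₂ (· * ·) congr($hν _) (by simp [ν, Algebra.TensorProduct.one_def])

theorem twist_baseChange (m : ℕ) (x : R ⊗[A] RootRing h m) (r : R) (b : B) (l : L) :
    (φ.baseChange hB).twist m (baseChangeMap R h hB m x ⊗ₜ[R ⊗[A] B] ((r ⊗ₜ[A] b) ⊗ₜ[R] l)) =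
      (1 ⊗ₜ toRoot hB (m + e) (b ^ p ^ m)) *
        baseChangeMap R h hB (m + e) (φ.twist m (x ⊗ₜ[R] (r • l))) := by
  induction x using TensorProduct.induction_on with
  | zero => simp
  | add x y hx hy =>
    rw [map_add, TensorProduct.add_tmul, map_add, hx, hy, TensorProduct.add_tmul, map_add, map_add,
      mul_add]
  | tmul s a =>
    obtain ⟨a, rfl⟩ := (toRoot h m).surjective a
    have hsmul : (s ⊗ₜ[A] (1 : B)) • ((r ⊗ₜ[A] b) ⊗ₜ[R] l) = ((s * r) ⊗ₜ[A] b) ⊗ₜ[R] l := by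
      rw [TensorProduct.smul_tmul', smul_eq_mul, Algebra.TensorProduct.tmul_mul_tmul, one_mul]
    rw [baseChangeMap_tmul, twist_tmul, hsmul, baseChange_tmul, twist_tmul, map_mul, map_mul,
      rootInclusion_tmul, ← baseChangeMap_rootInclusion, baseChangeMap_tmul, smul_smul,
      ← Algebra.TensorProduct.one_def]
    ring

theorem map_twistIdeal_baseChangeMap (m : ℕ) (I : Ideal (R ⊗[A] RootRing h m)) :
    (φ.twistIdeal m I).map (baseChangeMap R h hB (m + e)) =
      (φ.baseChange hB).twistIdeal m (I.map (baseChangeMap R h hB m)) := by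
  apply le_antisymm
  · rw [Ideal.map_le_iff_le_comap]
    refine (φ.gc_twistIdeal_twistComap _ _ _).2 fun x hx l => Ideal.mem_comap.2 ?_
    have htwist := φ.twist_baseChange hB m x 1 1 l
    simp only [one_smul, one_pow, map_one, ← Algebra.TensorProduct.one_def, one_mul] at htwist
    exact htwist ▸ (φ.baseChange hB).twist_mem_twistIdeal (Ideal.mem_map_of_mem _ hx) _
  · refine ((φ.baseChange hB).gc_twistIdeal_twistComap _ _ _).2 ?_
    refine Ideal.map_le_iff_le_comap.2 fun x hx y => ?_
    induction y using TensorProduct.induction_on with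
    | zero => simp
    | add y z hy hz => rw [TensorProduct.tmul_add, map_add]; exact add_mem hy hz
    | tmul c l =>
      induction c using TensorProduct.induction_on with
      | zero => simp
      | add c d hc hd =>
        rw [TensorProduct.add_tmul, TensorProduct.tmul_add, map_add]
        exact add_mem hc hd
      | tmul r b =>
        rw [twist_baseChange]
        exact Ideal.mul_mem_left _ _
          (Ideal.mem_map_of_mem _ (φ.twist_mem_twistIdeal hx (r • l)))

theorem sigmaExtended_eq_sigmaBaseChange (hR : (p : R) = 0) (n : ℕ) :
    φ.sigmaExtended hR hB n = φ.sigmaBaseChange hB n := by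
  induction n with
  | zero => rw [sigmaExtended, sigmaBaseChange, sigma_zero, sigma_zero, Ideal.map_top]
  | succ n ih =>
    rw [sigmaExtended, sigmaBaseChange, sigma_succ, sigma_succ]
    exact (φ.map_twistIdeal_baseChangeMap hB (e * n) _).trans congr(twistIdeal _ _ $ih)

end RelCartierMap

end BaseChange

section PerfectField

variable {K : Type u} [Field K] [CharP K p] [PerfectField K] {hK : (p : K) = 0}
  {S M : Type u} [CommRing S] [Algebra K S]

theorem perfectIdent_tmul (m : ℕ) (s : S) (a : K) :
    perfectIdent hK S m (s ⊗ₜ toRoot hK m a) =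
      s * algebraMap K S ((iterateFrobeniusEquiv K p m).symm a) := rfl

theorem perfectIdent_rootInclusion (e m : ℕ) (x : S ⊗[K] RootRing hK e) :
    perfectIdent hK S (m + e) (rootInclusion S hK e m x) = perfectIdent hK S e x := by
  suffices (perfectIdent hK S (m + e)).toRingHom.comp (rootInclusion S hK e m).toRingHom =
      (perfectIdent hK S e).toRingHom from congr($this x)
  refine ringHom_ext_tmul_toRoot fun s a => ?_
  change perfectIdent hK S (m + e) (rootInclusion S hK e m (s ⊗ₜ toRoot hK e a)) =
    perfectIdent hK S e (s ⊗ₜ toRoot hK e a)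
  rw [rootInclusion_tmul, perfectIdent_tmul, perfectIdent_tmul, add_comm m e,
    iterateFrobeniusEquiv_symm_add_apply, ← iterateFrobeniusEquiv_def, RingEquiv.symm_apply_apply]

namespace RelCartierMap

variable {e : ℕ} [AddCommGroup M] [Module S M] (φ : RelCartierMap hK e S M)

theorem perfectIdent_twist (m : ℕ) (x : S ⊗[K] RootRing hK m) (l : M) :
    perfectIdent hK S (m + e) (φ.twist m (x ⊗ₜ[S] l)) =
      φ.toCartierMap.toFun (perfectIdent hK S m x • l) := by
  induction x using TensorProduct.induction_on with
  | zero => simp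
  | add x y hx hy =>
    rw [TensorProduct.add_tmul, map_add, map_add, hx, hy, map_add, add_smul, map_add]
  | tmul s a =>
    obtain ⟨a, rfl⟩ := (toRoot hK m).surjective a
    rw [twist_tmul, map_mul, perfectIdent_rootInclusion, perfectIdent_tmul, perfectIdent_tmul,
      one_mul, mul_comm s, mul_smul]
    change _ = perfectIdent hK S e (φ.toFun _)
    rw [φ.map_base_smul, map_mul, perfectIdent_tmul, one_mul, mul_comm, add_comm m e,
      iterateFrobeniusEquiv_symm_add_apply]

theorem map_twistIdeal_perfectIdent (m : ℕ) (I : Ideal (S ⊗[K] RootRing hK m)) :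
    (φ.twistIdeal m I).map (perfectIdent hK S (m + e)) =
      φ.toCartierMap.mapIdeal (I.map (perfectIdent hK S m)) := by
  apply le_antisymm
  · rw [Ideal.map_le_iff_le_comap]
    refine (φ.gc_twistIdeal_twistComap _ _ _).2 fun x hx l => Ideal.mem_comap.2 ?_
    rw [perfectIdent_twist]
    exact φ.toCartierMap.apply_smul_mem_mapIdeal (Ideal.mem_map_of_mem _ hx) l
  · refine (φ.toCartierMap.gc_mapIdeal_comapIdeal _ _).2 ?_
    refine Ideal.map_le_iff_le_comap.2 fun x hx l => ?_
    rw [← perfectIdent_twist]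
    exact Ideal.mem_map_of_mem _ (φ.twist_mem_twistIdeal hx l)

theorem map_sigma_perfectIdent (hS : (p : S) = 0) (n : ℕ) :
    (φ.sigma hS n).map (perfectIdent hK S (e * n)) = φ.toCartierMap.iterImage n := by
  induction n with
  | zero => rw [sigma_zero, Ideal.map_top, CartierMap.iterImage_zero]
  | succ n ih =>
    rw [sigma_succ, CartierMap.iterImage_succ, ← ih]
    exact φ.map_twistIdeal_perfectIdent (e * n) _

end RelCartierMap

end PerfectField

section Fiber

attribute [local instance] Algebra.TensorProduct.rightAlgebra

section RootEval

variable (D : Type u) [CommRing D] [ExpChar D p] [PerfectRing D p] [Algebra A D]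

/-- The map `A^{1/p^m} → D` induced by `A → D`, for a perfect ring `D`. -/
def rootToPerfect (h : (p : A) = 0) (m : ℕ) : RootRing h m →ₐ[A] D :=
  { ((iterateFrobeniusEquiv D p m).symm.toRingHom.comp (algebraMap A D)).comp
      (toRoot h m).symm.toRingHom with
    commutes' := fun a => by
      exact (congrArg _ (map_pow (algebraMap A D) a _)).trans
        ((iterateFrobeniusEquiv D p m).symm_apply_apply _) }

/-- The map `R_{A^{1/p^m}} → R_D` induced by `A → D`, for a perfect ring `D`. -/
def rootEval (R : Type u) [CommRing R] [Algebra A R] (h : (p : A) = 0) (m : ℕ) :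
    R ⊗[A] RootRing h m →ₐ[R] R ⊗[A] D :=
  Algebra.TensorProduct.map (AlgHom.id R R) (rootToPerfect D h m)

theorem rootEval_tmul (m : ℕ) (r : R) (a : A) :
    rootEval D R h m (r ⊗ₜ toRoot h m a) =
      r ⊗ₜ (iterateFrobeniusEquiv D p m).symm (algebraMap A D a) := rfl

theorem map_comp_rootEval {D' : Type u} [CommRing D'] [ExpChar D' p] [PerfectRing D' p]
    [Algebra A D'] (g : D →ₐ[A] D') (m : ℕ) :
    (Algebra.TensorProduct.map (AlgHom.id R R) g).toRingHom.comp (rootEval D R h m).toRingHom =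
      (rootEval D' R h m).toRingHom :=
  ringHom_ext_tmul_toRoot fun r a =>
    congrArg (r ⊗ₜ ·) ((map_iterateFrobeniusEquiv_symm g.toRingHom m _).trans
      (congrArg _ (g.commutes a)))

end RootEval

variable (K : Type u) [Field K] [CharP K p] [PerfectField K] [Algebra A K]

theorem perfectIdent_comp_baseChangeMap (m : ℕ) :
    (perfectIdent (CharP.cast_eq_zero K p) (R ⊗[A] K) m).toRingHom.comp
      (baseChangeMap R h (CharP.cast_eq_zero K p) m) = (rootEval K R h m).toRingHom := by
  refine ringHom_ext_tmul_toRoot fun r a => ?_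
  change perfectIdent _ _ m (baseChangeMap R h _ m _) = rootEval K R h m _
  rw [rootEval_tmul, baseChangeMap_tmul, perfectIdent_tmul]
  change (r ⊗ₜ 1) * (1 ⊗ₜ _) = _
  rw [Algebra.TensorProduct.tmul_mul_tmul, mul_one, one_mul]

namespace RelCartierMap

variable {e : ℕ} {L : Type u} [AddCommGroup L] [Module R L] (φ : RelCartierMap h e R L)

theorem fiberMap_tmul (r : R) (k : K) (l : L) :
    (φ.fiberMap K).toFun ((r ⊗ₜ[A] k) ⊗ₜ[R] l) =
      rootEval K R h e (φ.toFun (r • l)) * (1 ⊗ₜ (iterateFrobeniusEquiv K p e).symm k) := by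
  change perfectIdent _ _ e ((φ.baseChange _).toFun ((r ⊗ₜ[A] k) ⊗ₜ[R] l)) = _
  rw [baseChange_tmul, map_mul, perfectIdent_tmul, one_mul]
  exact congr($(perfectIdent_comp_baseChangeMap K e) _ * _)

theorem sigmaOnFiber_eq_iterImage (hR : (p : R) = 0) (n : ℕ) :
    φ.sigmaOnFiber K hR n = (φ.fiberMap K).iterImage n := by
  rw [sigmaOnFiber, sigmaExtended_eq_sigmaBaseChange]
  exact (φ.baseChange _).map_sigma_perfectIdent _ n

theorem map_sigma_rootEval (hR : (p : R) = 0) (n : ℕ) :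
    (φ.sigma hR n).map (rootEval K R h (e * n)) = (φ.fiberMap K).iterImage n := by
  rw [← φ.sigmaOnFiber_eq_iterImage K hR, sigmaOnFiber, sigmaExtended]
  exact congr(Ideal.map $(perfectIdent_comp_baseChangeMap K (e * n)) _).symm.trans
    (Ideal.map_map _ _).symm

end RelCartierMap

end Fiber

end RelativeImages

/-! ### Uniform stabilization over an affine base -/

section PerfectClosure

variable (k : Type*) [CommRing k] [IsDomain k] (p : ℕ) [Fact p.Prime] [CharP k p]

theorem isDomain_perfectClosure : IsDomain (PerfectClosure k p) := by
  have hinj : Function.Injective (PerfectClosure.of k p) := fun x y hxy => by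
    simpa [PerfectClosure.of_apply, PerfectClosure.eq_iff] using hxy
  have hker : RingHom.ker (PerfectClosure.of k p) ≤ nilradical k :=
    ((RingHom.injective_iff_ker_eq_bot _).1 hinj).trans_le bot_le
  have hspec := PrimeSpectrum.isHomeomorph_comap (PerfectClosure.of k p) (fun x => by
    obtain ⟨n, y, hy⟩ := IsPRadical.pow_mem (PerfectClosure.of k p) p x
    exact ⟨p ^ n, pow_pos (Fact.out : p.Prime).pos n, y, hy⟩) hker
  have hprime := PrimeSpectrum.irreducibleSpace_iff_isPrime_nilradical.1
    ((hspec.homeomorph _).irreducibleSpace_iff.2 inferInstance)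
  rw [nilradical_eq_zero] at hprime
  exact IsDomain.of_bot_isPrime _

theorem perfectRing_fractionRing [PerfectRing k p] [CharP (FractionRing k) p] :
    PerfectRing (FractionRing k) p := by
  refine PerfectRing.ofSurjective _ p fun x => ?_
  obtain ⟨a, b, hb, rfl⟩ := IsFractionRing.div_surjective (A := k) x
  obtain ⟨a, rfl⟩ := surjective_frobenius k p a
  obtain ⟨b, rfl⟩ := surjective_frobenius k p b
  exact ⟨algebraMap k _ a / algebraMap k _ b, by simp [frobenius_def]⟩

end PerfectClosure

section NoetherianInduction

variable {A : Type*} [CommRing A] [IsNoetherianRing A]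

theorem exists_forall_primeSpectrum {P : ℕ → PrimeSpectrum A → Prop}
    (hmono : ∀ q, Monotone (P · q))
    (hP : ∀ q₀ : PrimeSpectrum A, ∃ N, ∃ a ∉ q₀.asIdeal,
      ∀ q ≥ q₀, a ∉ q.asIdeal → P N q) :
    ∃ N, ∀ q, P N q := by
  suffices ∀ I : Ideal A, ∃ N, ∀ q : PrimeSpectrum A, I ≤ q.asIdeal → P N q by
    obtain ⟨N, hN⟩ := this ⊥
    exact ⟨N, fun q => hN q bot_le⟩
  refine IsNoetherian.induction fun (I : Ideal A) ih => ?_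
  by_cases hI : I.IsPrime
  · obtain ⟨N, a, ha, hN⟩ := hP ⟨I, hI⟩
    obtain ⟨N', hN'⟩ := ih (I ⊔ Ideal.span {a}) <| left_lt_sup.2 fun h =>
      ha (h (Ideal.mem_span_singleton_self a))
    refine ⟨max N N', fun q hq => ?_⟩
    by_cases haq : a ∈ q.asIdeal
    · exact hmono q (le_max_right N N')
        (hN' q (sup_le hq ((Ideal.span_singleton_le_iff_mem _).2 haq)))
    · exact hmono q (le_max_left N N') (hN q hq haq)
  · have hlt (J : Ideal A) (hJ : J ∈ I.minimalPrimes) : I < J :=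
      hJ.1.2.lt_of_ne fun h => hI (h ▸ hJ.1.1)
    choose! N hN using fun J hJ => ih J (hlt J hJ)
    obtain ⟨M, hM⟩ := (I.finite_minimalPrimes_of_isNoetherianRing.image N).bddAbove
    refine ⟨M, fun q hq => ?_⟩
    obtain ⟨J, hJ, hJq⟩ := Ideal.exists_minimalPrimes_le hq
    exact hmono q (hM (Set.mem_image_of_mem N hJ)) (hN J hJ q hJq)

end NoetherianInduction

theorem isNoetherianRing_tensorProduct (A R B : Type u) [CommRing A] [CommRing R] [CommRing B]
    [Algebra A R] [Algebra A B] [Algebra.FiniteType A R] [IsNoetherianRing B] :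
    IsNoetherianRing (R ⊗[A] B) := by
  have := Algebra.FiniteType.isNoetherianRing B (B ⊗[A] R)
  exact isNoetherianRing_of_ringEquiv _ (Algebra.TensorProduct.comm A B R).toRingEquiv

theorem exists_ne_zero_tmul_mem_colon {A R D : Type*} [CommRing A] [CommRing R] [CommRing D]
    [IsDomain D] [Algebra A R] [Algebra A D] {I J : Ideal (R ⊗[A] D)} (hI : I.FG)
    (h : I.map (Algebra.TensorProduct.map (AlgHom.id R R)
        (IsScalarTower.toAlgHom A D (FractionRing D))).toRingHom ≤
      J.map (Algebra.TensorProduct.map (AlgHom.id R R)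
        (IsScalarTower.toAlgHom A D (FractionRing D))).toRingHom) :
    ∃ d : D, d ≠ 0 ∧ (1 : R) ⊗ₜ[A] d ∈ J.colon (I : Set (R ⊗[A] D)) := by
  let f := Algebra.TensorProduct.map (AlgHom.id R R) (IsScalarTower.toAlgHom A D (FractionRing D))
  let : Algebra (R ⊗[A] D) (R ⊗[A] FractionRing D) := f.toRingHom.toAlgebra
  have : IsScalarTower R (R ⊗[A] D) (R ⊗[A] FractionRing D) :=
    .of_algebraMap_eq fun r => (f.commutes r).symm
  have := IsLocalization.tensorProduct_tensorProduct_right A R (nonZeroDivisors D)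
    (FractionRing D) (RingHom.ext fun d => by simp [f, RingHom.algebraMap_toAlgebra])
  obtain ⟨_, ⟨d, hd, rfl⟩, hcolon⟩ := exists_mem_submonoid_colon_of_map_le
    ((nonZeroDivisors D).map Algebra.TensorProduct.includeRight) (S := R ⊗[A] FractionRing D) hI h
  exact ⟨d, nonZeroDivisors.ne_zero hd, hcolon⟩

section Uniform

variable {p : ℕ} [Fact p.Prime] {A : Type u} [CommRing A] {h : (p : A) = 0} {e : ℕ}
  {R L : Type u} [CommRing R] [Algebra A R] [AddCommGroup L] [Module R L]

namespace RelCartierMap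

variable (hR : (p : R) = 0) (φ : RelCartierMap h e R L)

theorem iterImage_fiberMap_le_succ_of_mem_colon {D : Type u} [CommRing D] [CharP D p]
    [PerfectRing D p] [Algebra A D] {N : ℕ} {d : D}
    (hd : (1 : R) ⊗ₜ[A] d ∈
      ((φ.sigma hR (N + 1)).map (rootEval D R h (e * (N + 1))).toRingHom).colon
        ((φ.sigma hR N).map (rootEval D R h (e * N)).toRingHom : Set (R ⊗[A] D)))
    {K : Type u} [Field K] [CharP K p] [PerfectField K] [Algebra A K] (g : D →ₐ[A] K)
    (hgd : g d ≠ 0) :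
    (φ.fiberMap K).iterImage N ≤ (φ.fiberMap K).iterImage (N + 1) := by
  have hunit : IsUnit (Algebra.TensorProduct.map (AlgHom.id R R) g (1 ⊗ₜ d)) :=
    hgd.isUnit.map (Algebra.TensorProduct.includeRight : K →ₐ[A] R ⊗[A] K)
  rw [← φ.map_sigma_rootEval K hR, ← φ.map_sigma_rootEval K hR]
  have hle := map_le_map_of_mem_colon (Algebra.TensorProduct.map (AlgHom.id R R) g).toRingHom
    hd hunit
  rwa [Ideal.map_map, Ideal.map_map, map_comp_rootEval, map_comp_rootEval] at hle

variable [IsNoetherianRing A] [Algebra.FiniteType A R]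

theorem exists_ne_zero_tmul_mem_colon_map_sigma (he : 0 < e) (D : Type u) [CommRing D] [IsDomain D]
    [CharP D p] [PerfectRing D p] [Algebra A D] :
    ∃ N, ∃ d : D, d ≠ 0 ∧ (1 : R) ⊗ₜ[A] d ∈
      ((φ.sigma hR (N + 1)).map (rootEval D R h (e * (N + 1))).toRingHom).colon
        ((φ.sigma hR N).map (rootEval D R h (e * N)).toRingHom : Set (R ⊗[A] D)) := by
  have : CharP (FractionRing D) p := charP_of_injective_algebraMap
    (IsFractionRing.injective D (FractionRing D)) p
  have : PerfectRing (FractionRing D) p := perfectRing_fractionRing D p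
  have : PerfectField (FractionRing D) := PerfectRing.toPerfectField _ p
  have := isNoetherianRing_tensorProduct A R (FractionRing D)
  obtain ⟨N, hN⟩ := (φ.fiberMap (FractionRing D)).exists_iterImage_le_succ he
  have : IsNoetherianRing (RootRing h (e * N)) := inferInstanceAs (IsNoetherianRing A)
  have := isNoetherianRing_tensorProduct A R (RootRing h (e * N))
  refine ⟨N, exists_ne_zero_tmul_mem_colon (Ideal.FG.map (IsNoetherian.noetherian _) _) ?_⟩
  rw [Ideal.map_map, Ideal.map_map, map_comp_rootEval, map_comp_rootEval]
  rw [← φ.map_sigma_rootEval _ hR, ← φ.map_sigma_rootEval _ hR] at hN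
  exact hN

theorem exists_forall_iterImage_fiberMap_le_succ_of_isPrime (he : 0 < e) (P : Ideal A)
    [P.IsPrime] :
    ∃ N, ∃ a ∉ P, ∀ (K : Type u) [Field K] [CharP K p] [PerfectField K] [Algebra A K],
      P ≤ RingHom.ker (algebraMap A K) → a ∉ RingHom.ker (algebraMap A K) →
      (φ.fiberMap K).iterImage N ≤ (φ.fiberMap K).iterImage (N + 1) := by
  have hR : (p : R) = 0 := natCast_eq_zero_of_ringHom (algebraMap A R) h
  have : CharP (A ⧸ P) p := (CharP.charP_iff_prime_eq_zero Fact.out).2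
    (natCast_eq_zero_of_ringHom (Ideal.Quotient.mk P) h)
  let D := PerfectClosure (A ⧸ P) p
  let i : A ⧸ P →+* D := PerfectClosure.of (A ⧸ P) p
  let : Algebra A D := (i.comp (Ideal.Quotient.mk P)).toAlgebra
  have : IsDomain D := isDomain_perfectClosure (A ⧸ P) p
  obtain ⟨N, d, hd, hcolon⟩ := φ.exists_ne_zero_tmul_mem_colon_map_sigma hR he D
  obtain ⟨m, a, ha⟩ := IsPRadical.pow_mem i p d
  obtain ⟨a, rfl⟩ := Ideal.Quotient.mk_surjective a
  refine ⟨N, a, fun haP => hd ?_, fun K _ _ _ _ hP haK => ?_⟩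
  · rw [Ideal.Quotient.eq_zero_iff_mem.2 haP, map_zero] at ha
    exact eq_zero_of_pow_eq_zero ha.symm
  let j : A ⧸ P →+* K := Ideal.Quotient.lift P (algebraMap A K) hP
  let g : D →ₐ[A] K :=
    { PerfectRing.lift i j p with commutes' := fun x => PerfectRing.lift_comp_apply i j p _ }
  refine φ.iterImage_fiberMap_le_succ_of_mem_colon hR hcolon g fun hgd => haK ?_
  have hga : g (d ^ p ^ m) = algebraMap A K a := ha ▸ g.commutes a
  rw [RingHom.mem_ker, ← hga, map_pow, hgd, zero_pow (pow_ne_zero _ (Fact.out : p.Prime).ne_zero)]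

theorem exists_forall_iterImage_fiberMap_le_succ (he : 0 < e) :
    ∃ N, ∀ (K : Type u) [Field K] [CharP K p] [PerfectField K] [Algebra A K],
      (φ.fiberMap K).iterImage N ≤ (φ.fiberMap K).iterImage (N + 1) := by
  obtain ⟨N, hN⟩ := exists_forall_primeSpectrum
    (P := fun N q => ∀ (K : Type u) [Field K] [CharP K p] [PerfectField K] [Algebra A K],
      q.asIdeal = RingHom.ker (algebraMap A K) →
      (φ.fiberMap K).iterImage N ≤ (φ.fiberMap K).iterImage (N + 1))
    (fun q m n hmn hm K _ _ _ _ hq => (φ.fiberMap K).iterImage_le_succ_of_le (hm K hq) hmn)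
    fun q₀ => by
      obtain ⟨N, a, ha, hN⟩ := φ.exists_forall_iterImage_fiberMap_le_succ_of_isPrime he q₀.asIdeal
      exact ⟨N, a, ha, fun q hq haq K _ _ _ _ hK => hN K (hK ▸ hq) (hK ▸ haq)⟩
  exact ⟨N, fun K _ _ _ _ => hN ⟨_, RingHom.ker_isPrime (algebraMap A K)⟩ K rfl⟩

end RelCartierMap

end Uniform

/-! ### Localization of the images on a fiber -/

namespace CartierMap

variable {p e : ℕ} [Fact p.Prime] {S S' M M' : Type u} [CommRing S] [CommRing S'] [Algebra S S']
  [AddCommGroup M] [Module S M] [AddCommGroup M'] [Module S' M']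
  {ψ : CartierMap p e S M} {ψ' : CartierMap p e S' M'} (T : Submonoid S) [IsLocalization T S']
  (l : M →ₛₗ[algebraMap S S'] M')

include T in
theorem map_mapIdeal_of_isLocalization (hl : ∀ m', ∃ t ∈ T, ∃ m, algebraMap S S' t • m' = l m)
    (hψ : ∀ m, ψ'.toFun (l m) = algebraMap S S' (ψ.toFun m)) (I : Ideal S) :
    (ψ.mapIdeal I).map (algebraMap S S') = ψ'.mapIdeal (I.map (algebraMap S S')) := by
  apply le_antisymm
  · refine Ideal.map_le_iff_le_comap.2 ((ψ.gc_mapIdeal_comapIdeal _ _).2 fun a ha m => ?_)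
    rw [Ideal.mem_comap, ← hψ, map_smulₛₗ]
    exact ψ'.apply_smul_mem_mapIdeal (Ideal.mem_map_of_mem _ ha) _
  · refine (ψ'.gc_mapIdeal_comapIdeal _ _).2 (Ideal.map_le_iff_le_comap.2 fun a ha m' => ?_)
    obtain ⟨t, ht, m, hm⟩ := hl m'
    obtain ⟨k, hk⟩ : t ∣ t ^ p ^ e := dvd_pow_self t (pow_ne_zero e (Fact.out : p.Prime).ne_zero)
    have hu : IsUnit (algebraMap S S' t) := IsLocalization.map_units S' (⟨t, ht⟩ : T)
    have hsmul : algebraMap S S' t ^ p ^ e • algebraMap S S' a • m' = l (a • k • m) := by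
      rw [← map_pow, hk, mul_comm t k, map_mul, mul_smul, smul_comm _ (algebraMap S S' a), hm,
        map_smulₛₗ, map_smulₛₗ, smul_comm]
    rw [← Ideal.unit_mul_mem_iff_mem _ hu, ← ψ'.map_pow_smul, hsmul, hψ]
    exact Ideal.mem_map_of_mem _ (ψ.apply_smul_mem_mapIdeal ha _)

include T in
theorem map_iterImage_of_isLocalization (hl : ∀ m', ∃ t ∈ T, ∃ m, algebraMap S S' t • m' = l m)
    (hψ : ∀ m, ψ'.toFun (l m) = algebraMap S S' (ψ.toFun m)) (n : ℕ) :
    (ψ.iterImage n).map (algebraMap S S') = ψ'.iterImage n := by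
  induction n with
  | zero => exact Ideal.map_top _
  | succ n ih =>
    rw [iterImage_succ, iterImage_succ, ← ih, map_mapIdeal_of_isLocalization T l hl hψ]

end CartierMap

section Restriction

variable (A A' R R' K : Type u) [CommRing A] [CommRing A'] [CommRing R] [CommRing R'] [CommRing K]
  [Algebra A A'] [Algebra A R] [Algebra A' R'] [Algebra R R'] [Algebra A R'] [IsScalarTower A R R']
  [IsScalarTower A A' R'] [Algebra A K] [Algebra A' K] [IsScalarTower A A' K] {p : ℕ} [Fact p.Prime]

/-- The restriction `R ⊗_A K → R' ⊗_{A'} K` of functions on a fiber to the open subset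
`Spec R'`. -/
def fiberRestrict : R ⊗[A] K →ₐ[R] R' ⊗[A'] K :=
  (Algebra.TensorProduct.mapOfCompatibleSMul A' A R R' K).comp
    (Algebra.TensorProduct.map (Algebra.ofId R R') (AlgHom.id A K))

theorem fiberRestrict_tmul (r : R) (k : K) :
    fiberRestrict A A' R R' K (r ⊗ₜ k) = algebraMap R R' r ⊗ₜ k := rfl

theorem isLocalization_fiberRestrict [TensorProduct.CompatibleSMul A A' R' K] (T : Submonoid R)
    [IsLocalization T R'] :
    letI := (fiberRestrict A A' R R' K).toAlgebra
    IsLocalization (Algebra.algebraMapSubmonoid (R ⊗[A] K) T) (R' ⊗[A'] K) := by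
  let res := Algebra.TensorProduct.map (Algebra.ofId R R') (AlgHom.id A K)
  let _ := res.toAlgebra
  let _ := (fiberRestrict A A' R R' K).toAlgebra
  have : IsScalarTower R (R ⊗[A] K) (R' ⊗[A] K) := .of_algebraMap_eq fun r => (res.commutes r).symm
  have : IsLocalization (Algebra.algebraMapSubmonoid (R ⊗[A] K) T) (R' ⊗[A] K) :=
    IsLocalization.tensorProduct_tensorProduct A K T R' <| RingHom.ext fun k =>
      (Algebra.TensorProduct.map_tmul ..).trans (congrArg (· ⊗ₜ k) (map_one _))
  exact IsLocalization.isLocalization_of_algEquiv _ <| AlgEquiv.ofRingEquiv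
    (f := (Algebra.TensorProduct.equivOfCompatibleSMul A' A R' R' K).toRingEquiv) fun _ => rfl

/-- The restriction `R_{A^{1/p^m}} → R'_{A'^{1/p^m}}`. -/
def rootRestrict (h : (p : A) = 0) (h' : (p : A') = 0) (m : ℕ) :
    R ⊗[A] RootRing h m →+* R' ⊗[A'] RootRing h' m :=
  Algebra.TensorProduct.mapRingHom (algebraMap A A') (algebraMap R R') (rootMap h h' m)
    (by rw [← IsScalarTower.algebraMap_eq, ← IsScalarTower.algebraMap_eq])
    (by ext a; simp [rootMap, algebraMap_root])

theorem rootRestrict_tmul (h : (p : A) = 0) (h' : (p : A') = 0) (m : ℕ) (r : R)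
    (a : RootRing h m) :
    rootRestrict A A' R R' h h' m (r ⊗ₜ a) = algebraMap R R' r ⊗ₜ rootMap h h' m a :=
  Algebra.TensorProduct.mapRingHom_tmul ..

theorem rootEval_comp_rootRestrict [ExpChar K p] [PerfectRing K p]
    (h : (p : A) = 0) (h' : (p : A') = 0) (m : ℕ) :
    (rootEval K R' h' m).toRingHom.comp (rootRestrict A A' R R' h h' m) =
      (fiberRestrict A A' R R' K).toRingHom.comp (rootEval K R h m).toRingHom :=
  ringHom_ext_tmul_toRoot fun r a => by
    change rootEval K R' h' m (rootRestrict A A' R R' h h' m (r ⊗ₜ toRoot h m a)) =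
      algebraMap R R' r ⊗ₜ (iterateFrobeniusEquiv K p m).symm (algebraMap A K a)
    rw [rootRestrict_tmul, IsScalarTower.algebraMap_apply A A' K a]
    rfl

variable {R R'} {L L' : Type u} [AddCommGroup L'] [Module R' L'] [AddCommGroup L] [Module R L]

/-- The restriction `L ⊗_A K → L' ⊗_{A'} K` of sections on a fiber to the open subset
`Spec R'`. -/
def fiberModuleRestrict (l : L →ₛₗ[algebraMap R R'] L') :
    (R ⊗[A] K) ⊗[R] L →ₛₗ[(fiberRestrict A A' R R' K).toRingHom] (R' ⊗[A'] K) ⊗[R'] L' :=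
  let F : R ⊗[A] K →ₛₗ[algebraMap R R'] R' ⊗[A'] K :=
    { (fiberRestrict A A' R R' K).toRingHom.toAddMonoidHom with
      map_smul' r x := (map_smul (fiberRestrict A A' R R' K) r x).trans
        (algebraMap_smul R' r (fiberRestrict A A' R R' K x)).symm }
  { TensorProduct.map F l with
    map_smul' s x := by
      change TensorProduct.map F l (s • x) =
        fiberRestrict A A' R R' K s • TensorProduct.map F l x
      induction x using TensorProduct.induction_on with
      | zero => simp only [smul_zero, map_zero]
      | add x y hx hy => simp only [smul_add, map_add, hx, hy]
      | tmul t x => exact congrArg (· ⊗ₜ[R'] l x) (map_mul (fiberRestrict A A' R R' K) s t) }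

theorem fiberModuleRestrict_tmul (l : L →ₛₗ[algebraMap R R'] L') (s : R ⊗[A] K) (x : L) :
    fiberModuleRestrict A A' K l (s ⊗ₜ[R] x) = fiberRestrict A A' R R' K s ⊗ₜ[R'] l x := rfl

variable {A A' K}

theorem exists_smul_eq_fiberModuleRestrict [TensorProduct.CompatibleSMul A A' R' K]
    (l : L →ₛₗ[algebraMap R R'] L') (T : Submonoid R) [IsLocalization T R']
    (hl : ∀ x' : L', ∃ t ∈ T, ∃ x, algebraMap R R' t • x' = l x) (z : (R' ⊗[A'] K) ⊗[R'] L') :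
    ∃ t ∈ Algebra.algebraMapSubmonoid (R ⊗[A] K) T, ∃ y,
      fiberRestrict A A' R R' K t • z = fiberModuleRestrict A A' K l y := by
  let _ := (fiberRestrict A A' R R' K).toAlgebra
  have := isLocalization_fiberRestrict A A' R R' K T
  induction z using TensorProduct.induction_on with
  | zero => exact ⟨1, one_mem _, 0, by rw [map_zero, smul_zero]⟩
  | add z w hz hw =>
    obtain ⟨s, hs, x, hx⟩ := hz
    obtain ⟨t, ht, y, hy⟩ := hw
    refine ⟨s * t, mul_mem hs ht, t • x + s • y, ?_⟩
    rw [map_add, map_smulₛₗ, map_smulₛₗ, ← hx, ← hy, map_mul, smul_add, mul_smul, mul_smul,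
      smul_comm]
    rfl
  | tmul b x' =>
    obtain ⟨⟨c, s, hs⟩, hc⟩ := IsLocalization.surj (Algebra.algebraMapSubmonoid (R ⊗[A] K) T) b
    obtain ⟨t, ht, x, hx⟩ := hl x'
    refine ⟨s * algebraMap R _ t, mul_mem hs ⟨t, ht, rfl⟩, c ⊗ₜ x, ?_⟩
    have hc : b * fiberRestrict A A' R R' K s = fiberRestrict A A' R R' K c := hc
    rw [fiberModuleRestrict_tmul, ← hc, ← hx, ← TensorProduct.smul_tmul, TensorProduct.smul_tmul',
      map_mul, AlgHom.commutes, IsScalarTower.algebraMap_apply R R' (R' ⊗[A'] K), mul_comm b,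
      mul_comm (fiberRestrict A A' R R' K s), smul_eq_mul, mul_assoc, Algebra.smul_def]

end Restriction

section FiberRestriction

variable {A A' R R' : Type u} [CommRing A] [CommRing A'] [CommRing R] [CommRing R']
  [Algebra A A'] [Algebra A R] [Algebra A' R'] [Algebra R R'] [Algebra A R'] [IsScalarTower A R R']
  [IsScalarTower A A' R'] {p : ℕ} [Fact p.Prime] {h : (p : A) = 0} {h' : (p : A') = 0} {e : ℕ}
  {L L' : Type u} [AddCommGroup L] [Module R L] [AddCommGroup L'] [Module R' L']
  {φ : RelCartierMap h e R L} {φ' : RelCartierMap h' e R' L'} (l : L →ₛₗ[algebraMap R R'] L')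
  (K : Type u) [Field K] [CharP K p] [PerfectField K]
  [Algebra A K] [Algebra A' K] [IsScalarTower A A' K]

theorem fiberMap_fiberModuleRestrict
    (hφ : ∀ x, φ'.toFun (l x) = rootRestrict A A' R R' h h' e (φ.toFun x))
    (y : (R ⊗[A] K) ⊗[R] L) :
    (φ'.fiberMap K).toFun (fiberModuleRestrict A A' K l y) =
      fiberRestrict A A' R R' K ((φ.fiberMap K).toFun y) := by
  induction y using TensorProduct.induction_on with
  | zero => simp only [map_zero]
  | add x y hx hy => simp only [map_add, hx, hy]
  | tmul s x =>
    induction s using TensorProduct.induction_on with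
    | zero => simp only [TensorProduct.zero_tmul, map_zero]
    | add s t hs ht => simp only [TensorProduct.add_tmul, map_add, hs, ht]
    | tmul r k =>
      rw [fiberModuleRestrict_tmul, fiberRestrict_tmul, φ'.fiberMap_tmul K, φ.fiberMap_tmul K,
        map_mul, ← map_smulₛₗ, hφ, fiberRestrict_tmul, map_one]
      exact congr($(rootEval_comp_rootRestrict A A' R R' K h h' e) _ * _)

theorem map_iterImage_fiberRestrict
    (hφ : ∀ x, φ'.toFun (l x) = rootRestrict A A' R R' h h' e (φ.toFun x))
    [TensorProduct.CompatibleSMul A A' R' K] (T : Submonoid R) [IsLocalization T R']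
    (hl : ∀ x' : L', ∃ t ∈ T, ∃ x, algebraMap R R' t • x' = l x) (n : ℕ) :
    ((φ.fiberMap K).iterImage n).map (fiberRestrict A A' R R' K) =
      (φ'.fiberMap K).iterImage n := by
  let _ := (fiberRestrict A A' R R' K).toAlgebra
  have := isLocalization_fiberRestrict A A' R R' K T
  exact CartierMap.map_iterImage_of_isLocalization (Algebra.algebraMapSubmonoid (R ⊗[A] K) T)
    (fiberModuleRestrict A A' K l)
    (exists_smul_eq_fiberModuleRestrict (A := A) (A' := A') (K := K) l T hl)
    (fiberMap_fiberModuleRestrict l K hφ) n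

end FiberRestriction

/-! ### Sections of quasi-coherent sheaves -/

section QuasicoherentSections

variable {X : Scheme.{u}}

/-- A trivialization of `L` over `U`, as an isomorphism from a free sheaf of modules of rank one on
the site of open subsets of `U`. -/
def freeIsoOver {L : X.Modules} {U : X.Opens}
    (θ : L.restrict U.ι ≅ (SheafOfModules.unit U.toScheme.ringCatSheaf : U.toScheme.Modules)) :
    SheafOfModules.free PUnit.{u + 1} ≅ SheafOfModules.over (R := X.ringCatSheaf) L U :=
  coproductUniqueIso (fun _ : PUnit.{u + 1} => SheafOfModules.unit (X.ringCatSheaf.over U)) ≪≫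
  (Scheme.Modules.overEquiv U).functor.preimageIso (
    (Scheme.Modules.overFunctorEquiv U).app (SheafOfModules.unit X.ringCatSheaf) ≪≫
      Scheme.Modules.restrictUnitIso U.ι ≪≫ θ.symm ≪≫
      ((Scheme.Modules.overFunctorEquiv U).app L).symm)

theorem IsLineBundle.isQuasicoherent {L : X.Modules} (hL : IsLineBundle L) :
    L.IsQuasicoherent := by
  choose U hU θ using hL
  have hcover : (Opens.grothendieckTopology X).CoversTop U :=
    (Opens.coversTop_iff X U).2 <| eq_top_iff.2 fun x _ => Opens.mem_iSup.2 ⟨x, hU x⟩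
  have hover (x : X) : SheafOfModules.IsQuasicoherent.{u, u, u}
      (SheafOfModules.over (R := X.ringCatSheaf) L (U x)) :=
    (SheafOfModules.isQuasicoherent.{u, u, u} (X.ringCatSheaf.over (U x))).prop_of_iso
      (freeIsoOver (θ x).some) inferInstance
  exact SheafOfModules.IsQuasicoherent.of_coversTop.{u, u, u} (R := X.ringCatSheaf) L U hcover

/-- The restriction of functions, as a ring homomorphism between the rings of sections. -/
def funRes {U W : X.Opens} (h : W ≤ U) : Γ(X, U) →+* Γ(X, W) := (X.presheaf.map (homOfLE h).op).hom

/-- The restriction of sections of a sheaf of modules, as an additive homomorphism. -/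
def secRes (L : X.Modules) {U W : X.Opens} (h : W ≤ U) : Γ(L, U) →+ Γ(L, W) :=
  (L.presheaf.map (homOfLE h).op).hom

theorem secRes_secRes (L : X.Modules) {U W Z : X.Opens} (h : W ≤ U) (h' : Z ≤ W) (l : Γ(L, U)) :
    secRes L h' (secRes L h l) = secRes L (h'.trans h) l :=
  congr($(L.presheaf.map_comp (homOfLE h).op (homOfLE h').op) l).symm

theorem secRes_smul (L : X.Modules) {U W : X.Opens} (h : W ≤ U) (r : Γ(X, U)) (l : Γ(L, U)) :
    secRes L h (r • l) = funRes h r • secRes L h l :=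
  Scheme.Modules.map_smul L _ r l

theorem fromSpec_image_le {U : X.Opens} (hU : IsAffineOpen U) (O : (Spec Γ(X, U)).Opens) :
    hU.fromSpec ''ᵁ O ≤ U :=
  (hU.fromSpec.image_le_opensRange O).trans hU.opensRange_fromSpec.le

theorem appIso_inv_fromSpec {U : X.Opens} (hU : IsAffineOpen U) (O : (Spec Γ(X, U)).Opens)
    (r : Γ(X, U)) :
    (hU.fromSpec.appIso O).inv ((Spec Γ(X, U)).presheaf.map O.leTop.op
      ((Scheme.ΓSpecIso Γ(X, U)).inv r)) = funRes (fromSpec_image_le hU O) r := by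
  have h : ((Scheme.ΓSpecIso Γ(X, U)).inv ≫ (Spec Γ(X, U)).presheaf.map O.leTop.op) ≫
      (hU.fromSpec.appIso O).inv = X.presheaf.map (homOfLE (fromSpec_image_le hU O)).op := by
    rw [Iso.comp_inv_eq, Scheme.Hom.appIso_hom', Scheme.Hom.map_appLE, Scheme.Hom.appLE,
      hU.fromSpec_app_self, Category.assoc, ← Functor.map_comp]
    rfl
  exact congr($h r)

theorem exists_map_eq_pow_smul_of_isQuasicoherent {R : CommRingCat.{u}} (M : (Spec R).Modules)
    [M.IsQuasicoherent] (g : R) {O : (Spec R).Opens} (hO : O = PrimeSpectrum.basicOpen g)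
    (m : Γ(M, O)) :
    ∃ (k : ℕ) (m' : Γ(M, ⊤)), M.presheaf.map O.leTop.op m' = g ^ k • m := by
  have : IsLocalizedModule (.powers g) ((modulesSpecToSheaf.obj M).obj.map O.leTop.op).hom :=
    hO ▸ (isIso_fromTildeΓ_iff_isLocalizing M).1 inferInstance g
  obtain ⟨⟨m', _, k, rfl⟩, h⟩ := IsLocalizedModule.surj (.powers g)
    ((modulesSpecToSheaf.obj M).obj.map O.leTop.op).hom m
  exact ⟨k, m', h.symm⟩

theorem exists_secRes_eq_pow_smul (L : X.Modules) [L.IsQuasicoherent] {U W : X.Opens}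
    (hU : IsAffineOpen U) (g : Γ(X, U)) (hW : W = X.basicOpen g) (hWU : W ≤ U) (m : Γ(L, W)) :
    ∃ (k : ℕ) (m' : Γ(L, U)), secRes L hWU m' = funRes hWU (g ^ k) • m := by
  obtain ⟨O, hO⟩ : ∃ O : (Spec Γ(X, U)).Opens, O = PrimeSpectrum.basicOpen g := ⟨_, rfl⟩
  obtain rfl : hU.fromSpec ''ᵁ O = W := by rw [hO, hW, ← hU.fromSpec_image_basicOpen]
  obtain ⟨k, m', h⟩ := exists_map_eq_pow_smul_of_isQuasicoherent (L.restrict hU.fromSpec) g hO m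
  have htop : U ≤ hU.fromSpec ''ᵁ ⊤ := by
    rw [Scheme.Hom.image_top_eq_opensRange, hU.opensRange_fromSpec]
  exact ⟨k, secRes L htop m', (secRes_secRes L htop hWU m').trans
    (h.trans (congrArg (· • m) (appIso_inv_fromSpec hU O (g ^ k))))⟩

end QuasicoherentSections

/-! ### Restriction to smaller charts -/

namespace Chart

variable {X V : Scheme.{u}} {f : X ⟶ V} {c d : Chart f}

/-- The chart `d` consists of smaller open sets than `c`. This is a class so that restriction of
functions becomes an algebra structure on the rings of `d`. -/
class Refines (d c : Chart f) : Prop where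
  U_le : d.U ≤ c.U
  W_le : d.W ≤ c.W

/-- The chart `d` consists of basic open sets of the two affine open sets of `c`. -/
class IsBasicIn (d c : Chart f) : Prop extends d.Refines c where
  exists_U_eq : ∃ g : c.R, d.U = X.basicOpen (U := c.U) g
  exists_W_eq : ∃ a : c.A, d.W = V.basicOpen (U := c.W) a

instance [d.Refines c] : Algebra c.A d.A := (funRes Refines.W_le).toAlgebra

instance [d.Refines c] : Algebra c.R d.R := (funRes Refines.U_le).toAlgebra

instance [d.Refines c] : Algebra c.A d.R :=
  ((algebraMap c.R d.R).comp (algebraMap c.A c.R)).toAlgebra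

instance [d.Refines c] : IsScalarTower c.A c.R d.R := .of_algebraMap_eq fun _ => rfl

instance [d.Refines c] : IsScalarTower c.A d.A d.R := .of_algebraMap_eq fun a =>
  congr($((f.appLE_map c.le (homOfLE Refines.U_le).op).trans
    (f.map_appLE d.le (homOfLE Refines.W_le).op).symm) a)

theorem exists_isBasicIn_of_mem_inf (c c' : Chart f) {x : X} (hx : x ∈ c.U ⊓ c'.U) :
    ∃ d : Chart f, x ∈ d.U ∧ d.IsBasicIn c ∧ d.IsBasicIn c' := by
  obtain ⟨a, b, hab, hxa⟩ :=
    exists_basicOpen_le_affine_inter c.affine_W c'.affine_W (f x) ⟨c.le hx.1, c'.le hx.2⟩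
  obtain ⟨g, g', hgg, hxg⟩ := exists_basicOpen_le_affine_inter c.affine_U c'.affine_U x hx
  have hmul (c : Chart f) (g : Γ(X, c.U)) (a : Γ(V, c.W)) :
      X.basicOpen (g * f.appLE c.W c.U c.le a) = X.basicOpen g ⊓ f ⁻¹ᵁ V.basicOpen a := by
    rw [Scheme.basicOpen_mul, Scheme.basicOpen_appLE, ← inf_assoc,
      inf_eq_left.2 (X.basicOpen_le g)]
  let d : Chart f :=
    { U := X.basicOpen g ⊓ f ⁻¹ᵁ V.basicOpen a
      W := V.basicOpen a
      affine_U := hmul c g a ▸ c.affine_U.basicOpen _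
      affine_W := c.affine_W.basicOpen _
      le := inf_le_right }
  exact ⟨d, ⟨hxg, hxa⟩,
    { U_le := inf_le_left.trans (X.basicOpen_le g)
      W_le := V.basicOpen_le a
      exists_U_eq := ⟨_, (hmul c g a).symm⟩
      exists_W_eq := ⟨a, rfl⟩ },
    { U_le := inf_le_left.trans (hgg.trans_le (X.basicOpen_le g'))
      W_le := hab.trans_le (V.basicOpen_le b)
      exists_U_eq := ⟨_, .trans (by rw [← hgg, ← hab]) (hmul c' g' b).symm⟩
      exists_W_eq := ⟨b, hab⟩ }⟩

section LocalMap

variable {p : ℕ} [Fact p.Prime] (hV : (p : Γ(V, ⊤)) = 0) (e : ℕ)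

variable (c d) in
theorem twistOpen_mono [d.Refines c] : d.twistOpen hV e ≤ c.twistOpen hV e :=
  inf_le_inf (fun _ hx => Refines.U_le (c := c) hx) fun _ hx => Refines.W_le (c := c) hx

theorem twistFst_algebraMap [d.Refines c] (r : c.R) :
    d.twistFst hV e (algebraMap c.R d.R r) =
      funRes (c.twistOpen_mono d hV e) (c.twistFst hV e r) :=
  let π := pullback.fst f (absFrobenius hV e)
  congr($((π.map_appLE inf_le_left (homOfLE Refines.U_le).op).trans
    (π.appLE_map inf_le_left (homOfLE (c.twistOpen_mono d hV e)).op).symm) r)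

theorem twistSnd_rootMap [d.Refines c] (a : RootRing (c.natCast_A hV) e) :
    d.twistSnd hV e (rootMap (c.natCast_A hV) (d.natCast_A hV) e a) =
      funRes (c.twistOpen_mono d hV e) (c.twistSnd hV e a) :=
  let π := pullback.snd f (absFrobenius hV e)
  congr($((π.map_appLE inf_le_right (homOfLE Refines.W_le).op).trans
    (π.appLE_map inf_le_right (homOfLE (c.twistOpen_mono d hV e)).op).symm) a)

variable (c) in
theorem twistEquiv_tmul (r : c.R) (a : RootRing (c.natCast_A hV) e) :
    c.twistEquiv hV e (r ⊗ₜ a) = c.twistFst hV e r * c.twistSnd hV e a := by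
  rw [← twistEquiv_left, ← twistEquiv_right, ← map_mul, Algebra.TensorProduct.tmul_mul_tmul,
    mul_one, one_mul]

theorem twistEquiv_rootRestrict [d.Refines c] (y : c.R ⊗[c.A] RootRing (c.natCast_A hV) e) :
    d.twistEquiv hV e (rootRestrict c.A d.A c.R d.R (c.natCast_A hV) (d.natCast_A hV) e y) =
      funRes (c.twistOpen_mono d hV e) (c.twistEquiv hV e y) := by
  induction y using TensorProduct.induction_on with
  | zero => simp only [map_zero]
  | add x y hx hy => simp only [map_add, hx, hy]
  | tmul r a =>
    rw [rootRestrict_tmul, twistEquiv_tmul, twistEquiv_tmul, twistFst_algebraMap,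
      twistSnd_rootMap, map_mul]

variable {hV e} {L : X.Modules} (φ : RelMap f hV e L)

theorem twistEquiv_localMap (x : c.Sec L) :
    c.twistEquiv hV e ((c.localMap hV e φ).toFun x) =
      (Scheme.Modules.Hom.app φ (c.twistOpen hV e)).hom
        (secRes L (c.preimage_twistOpen_le hV e) x) :=
  (c.twistEquiv hV e).apply_symm_apply _

variable (d L) in
/-- The restriction `L(U) → L(U')`, as a semilinear map. -/
def restrictSec [d.Refines c] : c.Sec L →ₛₗ[algebraMap c.R d.R] d.Sec L :=
  { secRes L Refines.U_le with map_smul' := secRes_smul L Refines.U_le }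

theorem localMap_restrictSec [d.Refines c] (x : c.Sec L) :
    (d.localMap hV e φ).toFun (c.restrictSec d L x) =
      rootRestrict c.A d.A c.R d.R (c.natCast_A hV) (d.natCast_A hV) e
        ((c.localMap hV e φ).toFun x) := by
  apply (d.twistEquiv hV e).injective
  rw [twistEquiv_rootRestrict, twistEquiv_localMap, twistEquiv_localMap]
  have hφ := congr($((Scheme.Modules.Hom.mapPresheaf φ).naturality
    (homOfLE (c.twistOpen_mono d hV e)).op) (secRes L (c.preimage_twistOpen_le hV e) x))
  exact (congrArg _ ((secRes_secRes L _ _ x).trans (secRes_secRes L _ _ x).symm)).trans hφ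

theorem exists_smul_eq_restrictSec [L.IsQuasicoherent] [d.Refines c] {g : c.R}
    (hg : d.U = X.basicOpen (U := c.U) g) (x' : d.Sec L) :
    ∃ t ∈ Submonoid.powers g, ∃ x, algebraMap c.R d.R t • x' = c.restrictSec d L x := by
  obtain ⟨k, x, hx⟩ := exists_secRes_eq_pow_smul L c.affine_U g hg Refines.U_le x'
  exact ⟨g ^ k, ⟨k, rfl⟩, x, hx.symm⟩

theorem isLocalization_R [d.Refines c] {g : c.R} (hg : d.U = X.basicOpen (U := c.U) g) :
    IsLocalization.Away g d.R :=
  c.affine_U.isLocalization_of_eq_basicOpen g (homOfLE Refines.U_le) hg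

theorem isLocalization_A [d.Refines c] {a : c.A} (ha : d.W = V.basicOpen (U := c.W) a) :
    IsLocalization.Away a d.A :=
  c.affine_W.isLocalization_of_eq_basicOpen a (homOfLE Refines.W_le) ha

end LocalMap

theorem compatibleSMul_of_isBasicIn (K : Type u) [CommRing K] [Algebra c.A K] [Algebra d.A K]
    [d.IsBasicIn c] [IsScalarTower c.A d.A K] : TensorProduct.CompatibleSMul c.A d.A d.R K := by
  obtain ⟨a, ha⟩ := IsBasicIn.exists_W_eq (d := d) (c := c)
  have := isLocalization_A ha
  exact IsLocalization.tensorProduct_compatibleSMul (.powers a) d.A d.R K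

section Stability

variable {p : ℕ} [Fact p.Prime] {hV : (p : Γ(V, ⊤)) = 0} {e : ℕ} {L : X.Modules}
  {φ : RelMap f hV e L} {K : Type u} [Field K] [CharP K p] [PerfectField K]

variable (c φ K) in
/-- On the fiber over a point `Spec K → W`, the images of the `n`-th and of the `(n + 1)`-st iterate
of `φ` agree: one inclusion suffices, the images being decreasing. -/
def StableAt [Algebra c.A K] (n : ℕ) : Prop :=
  ((c.localMap hV e φ).fiberMap K).iterImage n ≤ ((c.localMap hV e φ).fiberMap K).iterImage (n + 1)

variable [L.IsQuasicoherent]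
  [Algebra c.A K] [Algebra d.A K] [d.IsBasicIn c] [IsScalarTower c.A d.A K]

variable (c d φ K) in
theorem map_iterImage_localMap (n : ℕ) :
    (((c.localMap hV e φ).fiberMap K).iterImage n).map (fiberRestrict c.A d.A c.R d.R K) =
      ((d.localMap hV e φ).fiberMap K).iterImage n := by
  obtain ⟨g, hg⟩ := IsBasicIn.exists_U_eq (d := d) (c := c)
  have := isLocalization_R hg
  have := compatibleSMul_of_isBasicIn (c := c) (d := d) K
  exact map_iterImage_fiberRestrict (c.restrictSec d L) K (localMap_restrictSec φ) (.powers g)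
    (exists_smul_eq_restrictSec hg) n

theorem StableAt.restrict {n : ℕ} (h : c.StableAt φ K n) : d.StableAt φ K n := by
  rw [StableAt, ← map_iterImage_localMap c d φ K, ← map_iterImage_localMap c d φ K]
  exact Ideal.map_mono h

theorem StableAt.exists_tmul_mul_mem {n : ℕ} (h : d.StableAt φ K n) {y : c.R ⊗[c.A] K}
    (hy : y ∈ ((c.localMap hV e φ).fiberMap K).iterImage n) :
    ∃ t : c.R, d.U ≤ X.basicOpen (U := c.U) t ∧
      t ⊗ₜ 1 * y ∈ ((c.localMap hV e φ).fiberMap K).iterImage (n + 1) := by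
  obtain ⟨g, hg⟩ := IsBasicIn.exists_U_eq (d := d) (c := c)
  have := isLocalization_R hg
  have := compatibleSMul_of_isBasicIn (c := c) (d := d) K
  let _ := (fiberRestrict c.A d.A c.R d.R K).toAlgebra
  have := isLocalization_fiberRestrict c.A d.A c.R d.R K (.powers g)
  rw [StableAt, ← map_iterImage_localMap c d φ K, ← map_iterImage_localMap c d φ K] at h
  obtain ⟨_, ⟨_, ⟨k, rfl⟩, rfl⟩, hk⟩ := (IsLocalization.algebraMap_mem_map_algebraMap_iff
    (Algebra.algebraMapSubmonoid (c.R ⊗[c.A] K) (.powers g)) (d.R ⊗[d.A] K) _ y).1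
    (h (Ideal.mem_map_of_mem _ hy))
  refine ⟨g ^ (k + 1), hg.trans_le (X.basicOpen_pow (U := c.U) g k.succ_pos).ge, ?_⟩
  have hpow : (g ^ (k + 1)) ⊗ₜ 1 * y = g ⊗ₜ[c.A] (1 : K) * (algebraMap c.R _ (g ^ k) * y) := by
    rw [← mul_assoc, pow_succ', ← mul_one (1 : K), ← Algebra.TensorProduct.tmul_mul_tmul, mul_one]
    rfl
  exact hpow ▸ Ideal.mul_mem_left _ _ hk

end Stability

section Point

variable {K : Type u} [Field K] {s : Spec (.of K) ⟶ V}

theorem isScalarTower_pointAlgebra [d.Refines c] (hc : ⊤ ≤ s ⁻¹ᵁ c.W) (hd : ⊤ ≤ s ⁻¹ᵁ d.W) :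
    letI := c.pointAlgebra s hc
    letI := d.pointAlgebra s hd
    IsScalarTower c.A d.A K := by
  let _ := c.pointAlgebra s hc
  let _ := d.pointAlgebra s hd
  exact .of_algebraMap_eq fun a => congr((Scheme.ΓSpecIso (.of K)).hom
    ($(s.map_appLE hd (homOfLE Refines.W_le).op) a)).symm

theorem le_preimage_basicOpen (hs : ⊤ ≤ s ⁻¹ᵁ c.W) {a : c.A}
    (ha : letI := c.pointAlgebra s hs; algebraMap c.A K a ≠ 0) :
    ⊤ ≤ s ⁻¹ᵁ V.basicOpen (U := c.W) a := by
  have hunit : IsUnit (s.appLE c.W ⊤ hs a) :=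
    (isUnit_map_iff (Scheme.ΓSpecIso (.of K)).commRingCatIsoToRingEquiv _).1 (IsUnit.mk0 _ ha)
  exact inf_eq_left.1
    ((Scheme.basicOpen_appLE s _ _ hs a).symm.trans (Scheme.basicOpen_of_isUnit _ hunit))

variable {p : ℕ} [Fact p.Prime] {hV : (p : Γ(V, ⊤)) = 0} {e : ℕ} {L : X.Modules}
  {φ : RelMap f hV e L} [CharP K p] [PerfectField K]

variable (c φ) in
/-- Stability on the fiber over a point `s` of `V`, which is vacuous if `s` does not map to `W`. -/
def StableAtPoint (s : Spec (.of K) ⟶ V) (n : ℕ) : Prop :=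
  ∀ hs : ⊤ ≤ s ⁻¹ᵁ c.W, letI := c.pointAlgebra s hs; c.StableAt φ K n

theorem StableAtPoint.of_le {N n : ℕ} (h : c.StableAtPoint φ s N) (hn : N ≤ n) :
    c.StableAtPoint φ s n := fun hs => CartierMap.iterImage_le_succ_of_le _ (h hs) hn

variable [L.IsQuasicoherent] {n : ℕ}

theorem StableAtPoint.restrict [d.IsBasicIn c] (h : c.StableAtPoint φ s n) :
    d.StableAtPoint φ s n := fun hd => by
  have hc : ⊤ ≤ s ⁻¹ᵁ c.W := hd.trans fun _ hz => Refines.W_le (d := d) hz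
  let _ := c.pointAlgebra s hc
  let _ := d.pointAlgebra s hd
  have := isScalarTower_pointAlgebra (c := c) hc hd
  exact (h hc).restrict

theorem StableAtPoint.exists_tmul_mul_mem [d.IsBasicIn c] (h : d.StableAtPoint φ s n)
    (hs : ⊤ ≤ s ⁻¹ᵁ c.W) :
    letI := c.pointAlgebra s hs
    ∀ y ∈ ((c.localMap hV e φ).fiberMap K).iterImage n, ∃ t : c.R,
      d.U ≤ X.basicOpen (U := c.U) t ∧
        t ⊗ₜ 1 * y ∈ ((c.localMap hV e φ).fiberMap K).iterImage (n + 1) := by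
  let _ := c.pointAlgebra s hs
  intro y hy
  obtain ⟨a, ha⟩ := IsBasicIn.exists_W_eq (d := d) (c := c)
  by_cases ha0 : algebraMap c.A K a = 0
  · -- The fiber over `s` does not meet `f ⁻¹ D(a)`, which contains the first open set of `d`.
    refine ⟨algebraMap c.A c.R a, ?_, ?_⟩
    · exact fun _ hz => (Scheme.basicOpen_appLE f _ _ c.le a).ge
        ⟨Refines.U_le (c := c) hz, ha.le (d.le hz)⟩
    · rw [Algebra.TensorProduct.tmul_one_eq_one_tmul, ha0, TensorProduct.tmul_zero, zero_mul]
      exact zero_mem _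
  · have hd : ⊤ ≤ s ⁻¹ᵁ d.W := ha ▸ le_preimage_basicOpen hs ha0
    let _ := d.pointAlgebra s hd
    have := isScalarTower_pointAlgebra (c := c) hs hd
    exact (h hd).exists_tmul_mul_mem hy

theorem stableAtPoint_of_cover (c : Chart f)
    (h : ∀ x ∈ c.U, ∃ c' : Chart f, x ∈ c'.U ∧ c'.StableAtPoint φ s n) :
    c.StableAtPoint φ s n := fun hs => by
  let _ := c.pointAlgebra s hs
  intro y hy
  let J : Ideal c.R :=
    ((((c.localMap hV e φ).fiberMap K).iterImage (n + 1)).colon {y}).comap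
      (Algebra.TensorProduct.includeLeftRingHom : c.R →+* c.R ⊗[c.A] K)
  have hJ (t : c.R) : t ∈ J ↔ t ⊗ₜ 1 * y ∈ _ := Submodule.mem_colon_singleton
  suffices hJ_top : J = ⊤ by
    have h1 := (hJ 1).1 (hJ_top ▸ Submodule.mem_top)
    rwa [← Algebra.TensorProduct.one_def, one_mul] at h1
  rw [← Ideal.span_eq J]
  refine c.affine_U.self_le_iSup_basicOpen_iff.1 fun x hx => ?_
  obtain ⟨c', hx', hc'⟩ := h x hx
  obtain ⟨d, hxd, hd, hd'⟩ := exists_isBasicIn_of_mem_inf c c' ⟨hx, hx'⟩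
  obtain ⟨t, ht, hty⟩ := hc'.restrict (d := d).exists_tmul_mul_mem hs y hy
  exact Opens.mem_iSup.2 ⟨⟨t, (hJ t).2 hty⟩, ht hxd⟩

end Point

end Chart

section UniformStability

variable {p : ℕ} [Fact p.Prime] {X V : Scheme.{u}} {f : X ⟶ V} {hV : (p : Γ(V, ⊤)) = 0} {e : ℕ}
  {L : X.Modules}

variable (f) in
theorem exists_chart (x : X) : ∃ c : Chart f, x ∈ c.U := by
  obtain ⟨W, hW, hxW, -⟩ := exists_isAffineOpen_mem_and_subset (x := f x) (U := ⊤) trivial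
  obtain ⟨U, hU, hxU, hUW⟩ := exists_isAffineOpen_mem_and_subset (x := x) (U := f ⁻¹ᵁ W) hxW
  exact ⟨⟨U, W, hU, hW, hUW⟩, hxU⟩

theorem Chart.exists_forall_stableAtPoint [IsLocallyNoetherian V] [LocallyOfFiniteType f]
    (he : 0 < e) (φ : RelMap f hV e L) (c : Chart f) :
    ∃ N, ∀ (K : Type u) [Field K] [CharP K p] [PerfectField K] (s : Spec (.of K) ⟶ V),
      c.StableAtPoint φ s N := by
  have : IsNoetherianRing c.A := IsLocallyNoetherian.component_noetherian ⟨c.W, c.affine_W⟩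
  have : Algebra.FiniteType c.A c.R := f.finiteType_appLE c.affine_W c.affine_U c.le
  obtain ⟨N, hN⟩ := (c.localMap hV e φ).exists_forall_iterImage_fiberMap_le_succ he
  exact ⟨N, fun K _ _ _ s hs => @hN K _ _ _ (c.pointAlgebra s hs)⟩

theorem exists_forall_chart_stableAtPoint [AlgebraicGeometry.IsNoetherian V]
    [LocallyOfFiniteType f] [QuasiCompact f] [L.IsQuasicoherent] (he : 0 < e)
    (φ : RelMap f hV e L) :
    ∃ N, ∀ (K : Type u) [Field K] [CharP K p] [PerfectField K] (s : Spec (.of K) ⟶ V)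
      (c : Chart f), c.StableAtPoint φ s N := by
  have : CompactSpace X := QuasiCompact.compactSpace_of_compactSpace f
  choose c hc using exists_chart f
  obtain ⟨t, ht⟩ := CompactSpace.elim_nhds_subcover (fun x => ((c x).U : Set X))
    fun x => (c x).U.isOpen.mem_nhds (hc x)
  choose N hN using fun x => (c x).exists_forall_stableAtPoint he φ
  refine ⟨t.sup N, fun K _ _ _ s d => d.stableAtPoint_of_cover fun x _ => ?_⟩
  obtain ⟨y, hy, hxy⟩ := Set.mem_iUnion₂.1 (ht.ge (Set.mem_univ x))
  exact ⟨c y, hxy, (hN y K s).of_le (Finset.le_sup hy)⟩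

end UniformStability

end

end RelFPure

theorem mainTheorem1_general {p : ℕ} [Fact p.Prime] {X V : Scheme.{u}} (f : X ⟶ V)
    [AlgebraicGeometry.IsNoetherian V] (hV : (p : Γ(V, ⊤)) = 0)
    [LocallyOfFiniteType f] [QuasiCompact f] (e : ℕ) (he : 0 < e) (L : X.Modules)
    [L.IsQuasicoherent] (φ : RelFPure.RelMap f hV e L) :
    (∃ N : ℕ, ∀ n : ℕ, N ≤ n →
      ∀ (K : Type u) [Field K] [CharP K p] [PerfectField K] (s : Spec (.of K) ⟶ V)
        (c : RelFPure.Chart f) (hs : ⊤ ≤ s ⁻¹ᵁ c.W),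
        letI := c.pointAlgebra s hs
        (c.localMap hV e φ).sigmaOnFiber K (c.natCast_R hV) n = (c.localMap hV e φ).fiberSigma K) ∧
    (∀ (n : ℕ) (T : Scheme.{u}) (g : T ⟶ V) (c : RelFPure.Chart f) (O : T.Opens)
        (hO : O ≤ g ⁻¹ᵁ c.W),
        letI := c.baseAlgebra g O hO
        (c.localMap hV e φ).sigmaExtended (c.natCast_R hV)
            (RelFPure.natCast_section (RelFPure.natCast_source g hV) O) n =
          (c.localMap hV e φ).sigmaBaseChange
            (RelFPure.natCast_section (RelFPure.natCast_source g hV) O) n) := by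
  refine ⟨?_, fun n T g c O hO => ?_⟩
  · obtain ⟨N, hN⟩ := RelFPure.exists_forall_chart_stableAtPoint he φ
    refine ⟨N, fun n hn K _ _ _ s c hs => ?_⟩
    let _ := c.pointAlgebra s hs
    rw [RelFPure.RelCartierMap.sigmaOnFiber_eq_iterImage]
    exact (RelFPure.CartierMap.sigma_eq_iterImage _ _ (hN K s c hs) hn).symm
  · let _ := c.baseAlgebra g O hO
    exact RelFPure.RelCartierMap.sigmaExtended_eq_sigmaBaseChange ..

theorem mainTheorem1 {p : ℕ} [Fact p.Prime] {X V : Scheme.{u}} (f : X ⟶ V)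
    [AlgebraicGeometry.IsNoetherian V] [IsIntegral V] (hV : (p : Γ(V, ⊤)) = 0)
    [LocallyOfFiniteType f] [QuasiCompact f] [IsSeparated f] [Flat f] [GeometricallyReduced f]
    (e : ℕ) (he : 0 < e) (L : X.Modules) (hL : RelFPure.IsLineBundle L) (φ : RelFPure.RelMap f hV e L) :
    (∃ N : ℕ, ∀ n : ℕ, N ≤ n →
      ∀ (K : Type u) [Field K] [CharP K p] [PerfectField K] (s : Spec (.of K) ⟶ V)
        (c : RelFPure.Chart f) (hs : ⊤ ≤ s ⁻¹ᵁ c.W),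
        letI := c.pointAlgebra s hs
        (c.localMap hV e φ).sigmaOnFiber K (c.natCast_R hV) n = (c.localMap hV e φ).fiberSigma K) ∧
    (∀ (n : ℕ) (T : Scheme.{u}) (g : T ⟶ V) (c : RelFPure.Chart f) (O : T.Opens), IsAffineOpen O →
        ∀ hO : O ≤ g ⁻¹ᵁ c.W,
        letI := c.baseAlgebra g O hO
        (c.localMap hV e φ).sigmaExtended (c.natCast_R hV)
            (RelFPure.natCast_section (RelFPure.natCast_source g hV) O) n =
          (c.localMap hV e φ).sigmaBaseChange (RelFPure.natCast_section (RelFPure.natCast_source g hV) O) n) := by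
  have := hL.isQuasicoherent
  exact (mainTheorem1_general f hV e he L φ).imp_right fun h n T g c O _ hO => h n T g c O hO
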